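/- Let $(X,\mu)$ be a measure space, let $p\ge 3$ and $1/p+1/p'=1$. For real- or complex-valued $f_1,f_2,f_3\in L^p(X,\mu)$, not all zero almost everywhere, put $$\Gamma_p(f_1,f_2,f_3)=\frac{\big\|\tfrac13\big(|f_1f_2|+|f_1f_3|+|f_2f_3|\big)\big\|_{p/2}^{p/2}}{\tfrac13\big(\|f_1\|_p^p+\|f_2\|_p^p+\|f_3\|_p^p\big)},$$ and put $\Gamma_p=0$ if all three functions vanish almost everywhere. For $r>0$ consider the inequality $$\|f_1+f_2+f_3\|_p\le\big(1+2\,\Gamma_p(f_1,f_2,f_3)^{\,r}\big)^{1/p'}\Big(\sum_{j=1}^3\|f_j\|_p^p\Big)^{1/p}.\qquad(*)$$ Let $$\beta(3,p)=\frac{\ln 2}{(\frac p2-1)\ln 3+\ln 2}=\frac{2\ln 2}{(p-2)\ln 3+2\ln 2}=:c(p).$$ Then $(*)$ holds with $r=\beta(3,p)$ for all $f_1,f_2,f_3\in L^p(X,\mu)$. This power is optimal: if $X$ has a measurable subset of finite positive measure and $(*)$ holds with some power $r>0$ for all $f_1,f_2,f_3\in L^p(X,\mu)$, then $r\le\beta(3,p)$.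 The power improves the earlier power $6/(5p-4)$, that is, $\frac{6}{5p-4}<\beta(3,p)$. Moreover, the scalar inequality $$(x+y+z)^{p'}\le 1+\Big(2(xy+xz+yz)^{p/2}\Big)^{c(p)}$$ holds for all $x,y,z\ge 0$ with $x^p+y^p+z^p=1$. -/

import Mathlib

open MeasureTheory

/-- The quantity `Γ_p(f₁, …, fₙ)`: the `p/2`-th power of the `L^{p/2}` norm of the average of
`|f_j f_k|` over all pairs `j < k`, divided by the average of the numbers `‖f_j‖_p ^ p`.
It is `0` (as `0 / 0 = 0`) when all the `f_j` vanish almost everywhere. -/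
noncomputable def cflGamma {X 𝕜 : Type*} [MeasurableSpace X] [RCLike 𝕜] {n : ℕ}
    (p : ℝ) (μ : Measure X) (f : Fin n → X → 𝕜) : ℝ :=
  (lpNorm (fun x => ((n.choose 2 : ℕ) : ℝ)⁻¹ * ∑ j, ∑ k ∈ Finset.Ioi j, ‖f j x * f k x‖)
      (ENNReal.ofReal (p / 2)) μ) ^ (p / 2) /
    ((n : ℝ)⁻¹ * ∑ j, (lpNorm (f j) (ENNReal.ofReal p) μ) ^ p)

/-- The `n`-function Carlen–Frank–Lieb inequality with power `r`, on the measure space `(X, μ)`: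
`‖∑ f_j‖_p ≤ (1 + (n - 1) Γ_p(f₁, …, fₙ) ^ r) ^ (1 / p') (∑ ‖f_j‖_p ^ p) ^ (1 / p)`
for all `f₁, …, fₙ ∈ L^p(X, μ)` with values in `𝕜`, where `1 / p + 1 / p' = 1`. -/
def CFLInequality {X : Type*} [MeasurableSpace X] (𝕜 : Type*) [RCLike 𝕜]
    (μ : Measure X) (n : ℕ) (p r : ℝ) : Prop :=
  ∀ f : Fin n → X → 𝕜, (∀ j, MemLp (f j) (ENNReal.ofReal p) μ) →
    lpNorm (fun x => ∑ j, f j x) (ENNReal.ofReal p) μ ≤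
      (1 + ((n : ℝ) - 1) * cflGamma p μ f ^ r) ^ (1 / p.conjExponent) *
        (∑ j, (lpNorm (f j) (ENNReal.ofReal p) μ) ^ p) ^ (1 / p)

/-- The power `β(n, p)`, for `n ≥ 2`; at `n = 2` it is the limit `2 / p` of the formula. -/
noncomputable def cflBeta (n : ℕ) (p : ℝ) : ℝ :=
  if n = 2 then 2 / p
  else (Real.log ((n : ℝ) - 1) - Real.log ((n : ℝ) - 2)) /
    ((p / 2 - 1) * Real.log n + Real.log ((n : ℝ) - 1) - p / 2 * Real.log ((n : ℝ) - 2))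

/-! With c = `cflExp p`, S = x + y + z, s = xy + xz + yz and P = x^p + y^p + z^p, everything rests
on the homogeneous scalar bound S^(p/(p-1)) ≤ P^(1/(p-1)) (1 + (2 s^(p/2) / P)^c), which is
`pairBound`. It is an equality at (1,0,0), (1,1,0) and (1,1,1); c is the exponent fixed by
(2·3^(p/2-1))^c = 2, the case (1,1,1).

For fixed S and s the right side increases with P (`rpow_mul_one_add_div_rpow_le`), so only the
minimizers of P matter. These are (0,u,v) when s is small (`rpow_add_rpow_le_of_sum_eq`) and (a,b,b)
with a ≤ b otherwise (`rpow_add_two_mul_rpow_le_of_sum_eq`). By scaling there remain two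
inequalities in x ∈ [0,1], for (0,x,1) and (x,1,1): `one_add_rpow_le` and `two_add_rpow_le`. Near x
= 0 chords of convex and concave functions are compared; on the rest of the interval the logarithm
of the quotient of the two sides is monotone and vanishes at x = 1.

For functions, the scalar bound says pointwise |f₁+f₂+f₃|^p ≤ G(t) h, where h = Σ|f_j|^p, G(t) = (1
+ 2t^c)^(p-1), and t ∈ [0,1] is the pointwise analogue of Γ. Since Γ is the mean of t with respect
to h dμ and G is concave on [0,1], Jensen's inequality gives the claim. Optimality follows from the
equality case (1,1,0), applied to f = (1_A, 1_A, 0). -/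

/-- The exponent `log 2 / ((p / 2 - 1) log 3 + log 2)`. -/
noncomputable def cflExp (p : ℝ) : ℝ :=
  Real.log 2 / ((p / 2 - 1) * Real.log 3 + Real.log 2)

/-! ### Rational bounds for the exponent. -/

/-- The comparisons 3^5 < 2^8 and 2^19 < 3^12 place log 3 / log 2 between 19/12 and 8/5, whence
5/(4p-3) ≤ c ≤ 24/(19p-14). Estimates on c below use these bounds in place of logarithms. -/
theorem five_mul_log_three_le : 5 * Real.log 3 ≤ 8 * Real.log 2 := by
  have h : Real.log ((3 : ℝ) ^ 5) ≤ Real.log ((2 : ℝ) ^ 8) :=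
    Real.log_le_log (by norm_num) (by norm_num)
  rw [Real.log_pow, Real.log_pow] at h
  exact_mod_cast h

theorem nineteen_mul_log_two_le : 19 * Real.log 2 ≤ 12 * Real.log 3 := by
  have h : Real.log ((2 : ℝ) ^ 19) ≤ Real.log ((3 : ℝ) ^ 12) :=
    Real.log_le_log (by norm_num) (by norm_num)
  rw [Real.log_pow, Real.log_pow] at h
  exact_mod_cast h

theorem cflExp_denom_pos {p : ℝ} (hp : 3 ≤ p) :
    0 < (p / 2 - 1) * Real.log 3 + Real.log 2 := by
  have h2 : 0 < Real.log 2 := Real.log_pos (by norm_num)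
  have h3 : 0 < Real.log 3 := Real.log_pos (by norm_num)
  have : 0 < p / 2 - 1 := by linarith
  positivity

theorem cflExp_pos {p : ℝ} (hp : 3 ≤ p) : 0 < cflExp p :=
  div_pos (Real.log_pos (by norm_num)) (cflExp_denom_pos hp)

theorem cflExp_mul {p : ℝ} (hp : 3 ≤ p) :
    cflExp p * ((p / 2 - 1) * Real.log 3 + Real.log 2) = Real.log 2 :=
  div_mul_cancel₀ _ (cflExp_denom_pos hp).ne'

theorem cflExp_le {p : ℝ} (hp : 3 ≤ p) : cflExp p * (19 * p - 14) ≤ 24 := by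
  have h2 : 0 < Real.log 2 := Real.log_pos (by norm_num)
  have hc := cflExp_pos hp
  have h := cflExp_mul hp
  have key : cflExp p * (19 * p - 14) * Real.log 2 ≤ 24 * Real.log 2 := by
    have : (p / 2 - 1) * (19 * Real.log 2) ≤ (p / 2 - 1) * (12 * Real.log 3) :=
      mul_le_mul_of_nonneg_left nineteen_mul_log_two_le (by linarith)
    nlinarith
  exact le_of_mul_le_mul_right key h2

theorem le_cflExp {p : ℝ} (hp : 3 ≤ p) : 5 ≤ cflExp p * (4 * p - 3) := by
  have h2 : 0 < Real.log 2 := Real.log_pos (by norm_num)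
  have hc := cflExp_pos hp
  have h := cflExp_mul hp
  have key : 5 * Real.log 2 ≤ cflExp p * (4 * p - 3) * Real.log 2 := by
    have : (p / 2 - 1) * (5 * Real.log 3) ≤ (p / 2 - 1) * (8 * Real.log 2) :=
      mul_le_mul_of_nonneg_left five_mul_log_three_le (by linarith)
    nlinarith
  exact le_of_mul_le_mul_right key h2

theorem two_mul_rpow_cflExp {p : ℝ} (hp : 3 ≤ p) :
    (2 * (3 : ℝ) ^ (p / 2 - 1)) ^ cflExp p = 2 := by
  have h3 : (0 : ℝ) < 3 ^ (p / 2 - 1) := by positivity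
  rw [Real.rpow_def_of_pos (by positivity), Real.log_mul (by norm_num) h3.ne',
    Real.log_rpow (by norm_num), show (Real.log 2 + (p / 2 - 1) * Real.log 3) * cflExp p
      = cflExp p * ((p / 2 - 1) * Real.log 3 + Real.log 2) by ring, cflExp_mul hp,
    Real.exp_log (by norm_num)]

/-! ### Elementary inequalities for powers. -/

/-- The function `P ↦ P ^ d * (1 + (A / P) ^ c)` increases as long as `(A / P) ^ c ≤ 2`
and `2 c ≤ 3 d`. -/
theorem rpow_mul_one_add_div_rpow_le {P₁ P₂ A c d : ℝ} (hP₁ : 0 < P₁) (hP : P₁ ≤ P₂)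
    (hA : 0 ≤ A) (hd : 0 ≤ d) (hcd : 2 * c ≤ 3 * d) (hw : (A / P₁) ^ c ≤ 2) :
    P₁ ^ d * (1 + (A / P₁) ^ c) ≤ P₂ ^ d * (1 + (A / P₂) ^ c) := by
  have hP₂ : 0 < P₂ := hP₁.trans_le hP
  set w := (A / P₁) ^ c with hwdef
  have hw0 : 0 ≤ w := by positivity
  set s := Real.log (P₂ / P₁) with hs
  have hs0 : 0 ≤ s := Real.log_nonneg (by rwa [le_div_iff₀ hP₁, one_mul])
  have e1 : P₂ ^ d = P₁ ^ d * Real.exp (s * d) := by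
    rw [← Real.rpow_def_of_pos (by positivity), ← Real.mul_rpow hP₁.le (by positivity)]
    congr 1; field_simp
  have e2 : (A / P₂) ^ c = w * Real.exp (-(s * c)) := by
    have : A / P₂ = A / P₁ * (P₂ / P₁)⁻¹ := by field_simp
    rw [this, Real.mul_rpow (by positivity) (by positivity), Real.inv_rpow (by positivity),
      Real.rpow_def_of_pos (by positivity : 0 < P₂ / P₁), Real.exp_neg]
  rw [e1, e2, mul_assoc]
  refine mul_le_mul_of_nonneg_left ?_ (by positivity)
  rw [mul_add, mul_one, mul_left_comm, ← Real.exp_add]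
  -- The claim is now 1 + w ≤ e^(sd) + w e^(s(d-c)). Tangent lines at 0 suffice, because w ≤ 2 and
  -- 2c ≤ 3d give w(c-d) ≤ d.
  have h1 := Real.add_one_le_exp (s * d)
  have h2 := Real.add_one_le_exp (s * d + -(s * c))
  have h3 : w * (s * d + -(s * c) + 1) ≤ w * Real.exp (s * d + -(s * c)) :=
    mul_le_mul_of_nonneg_left h2 hw0
  have h4 : 0 ≤ s * (d - w * (c - d)) := by
    refine mul_nonneg hs0 ?_
    rcases le_total c d with h | h
    · nlinarith
    · nlinarith
  nlinarith

/-- A form of Bernoulli's inequality. -/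
theorem mul_rpow_mul_one_sub_sq_le {a x : ℝ} (ha : 2 ≤ a) (hx : 0 < x) :
    a * x ^ a * (1 - x ^ 2) ≤ 2 * x ^ 2 * (1 - x ^ a) := by
  have hb := one_add_mul_self_le_rpow_one_add (s := (x ^ 2)⁻¹ - 1) (p := a / 2)
    (by have : 0 < (x ^ 2)⁻¹ := by positivity
        linarith) (by linarith)
  have e : (1 + ((x ^ 2)⁻¹ - 1)) ^ (a / 2) = (x ^ a)⁻¹ := by
    rw [show 1 + ((x ^ 2)⁻¹ - 1) = (x ^ 2)⁻¹ by ring, Real.inv_rpow (by positivity),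
      ← Real.rpow_natCast, ← Real.rpow_mul hx.le]
    congr 2; push_cast; ring
  rw [e] at hb
  have hq : 0 < x ^ a := by positivity
  have h2 := mul_le_mul_of_nonneg_left hb (by positivity : 0 ≤ 2 * x ^ 2 * x ^ a)
  have e2 : 2 * x ^ 2 * x ^ a * (1 + a / 2 * ((x ^ 2)⁻¹ - 1))
      = 2 * x ^ 2 * x ^ a + a * x ^ a * (1 - x ^ 2) := by field_simp
  have e3 : 2 * x ^ 2 * x ^ a * (x ^ a)⁻¹ = 2 * x ^ 2 := by field_simp
  rw [e2, e3] at h2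
  linarith

/-- Comparison of convex with linear growth on `[0, 1]`. -/
theorem one_add_mul_rpow_le {t s e : ℝ} (ht : 0 ≤ t) (hs : 0 ≤ s) (hs1 : s ≤ 1) (he : 1 ≤ e) :
    (1 + s * t) ^ e ≤ 1 - s + s * (1 + t) ^ e := by
  have h := (convexOn_rpow he).2 (show (1 : ℝ) ∈ Set.Ici 0 by simp)
    (show 1 + t ∈ Set.Ici (0 : ℝ) by simp only [Set.mem_Ici]; linarith)
    (sub_nonneg.2 hs1) hs (by ring)
  simp only [smul_eq_mul, Real.one_rpow, mul_one] at h
  rwa [show 1 - s + s * (1 + t) = 1 + s * t by ring] at h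

theorem le_one_add_mul_rpow {t s e : ℝ} (ht : 0 ≤ t) (hs : 0 ≤ s) (hs1 : s ≤ 1) (he : 0 ≤ e)
    (he1 : e ≤ 1) : 1 - s + s * (1 + t) ^ e ≤ (1 + s * t) ^ e := by
  have h := (Real.concaveOn_rpow he he1).2 (show (1 : ℝ) ∈ Set.Ici 0 by simp)
    (show 1 + t ∈ Set.Ici (0 : ℝ) by simp only [Set.mem_Ici]; linarith)
    (sub_nonneg.2 hs1) hs (by ring)
  simp only [smul_eq_mul, Real.one_rpow, mul_one] at h
  rwa [show 1 - s + s * (1 + t) = 1 + s * t by ring] at h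

/-- The tangent line bound for `u ↦ b ^ u` below the point of tangency. -/
theorem rpow_ge_of_log_le {b u v l : ℝ} (hb : 0 < b) (hl : Real.log b ≤ l) (huv : u ≤ v) :
    b ^ v * (1 - l * (v - u)) ≤ b ^ u := by
  have e : b ^ u = b ^ v * Real.exp (Real.log b * (u - v)) := by
    rw [← Real.rpow_def_of_pos hb, ← Real.rpow_add hb]; congr 1; ring
  rw [e]
  refine mul_le_mul_of_nonneg_left ?_ (by positivity)
  have := Real.add_one_le_exp (Real.log b * (u - v))
  nlinarith

theorem log_nine_fifths_le : Real.log (9 / 5) ≤ 0.588 := by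
  rw [Real.log_le_iff_le_exp (by norm_num)]
  have := Real.sum_le_exp_of_nonneg (x := 0.588) (by norm_num) 6
  refine le_trans ?_ this
  norm_num [Finset.sum_range_succ, Nat.factorial]

theorem log_three_fifty_two_le : Real.log 3.52 ≤ 1.26 := by
  rw [Real.log_le_iff_le_exp (by norm_num)]
  have := Real.sum_le_exp_of_nonneg (x := 1.26) (by norm_num) 9
  refine le_trans ?_ this
  norm_num [Finset.sum_range_succ, Nat.factorial]

/-- Lower bounds for rational powers. -/
theorem le_rpow_div_of_pow_le {b t : ℝ} {m n : ℕ} (hn : n ≠ 0) (hb : 0 ≤ b) (ht : 0 ≤ t)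
    (h : t ^ n ≤ b ^ m) : t ≤ b ^ ((m : ℝ) / n) := by
  rw [div_eq_mul_inv, Real.rpow_mul hb, Real.rpow_natCast]
  rw [← Real.pow_rpow_inv_natCast ht hn]
  exact Real.rpow_le_rpow (by positivity) h (by positivity)

/-! ### The one-variable inequalities for (0, x, 1) and (x, 1, 1). -/

/-- A first-derivative test for the inequality on the segment from `(0, n - 1, 1)`-type to
equal arguments: `s = n + x` is the sum, `m = n + x ^ p` the power sum and
`t = n - 1 + n x` the second symmetric function. -/
theorem rpow_le_of_deriv_condition {p c n x₀ x : ℝ} (hp : 3 ≤ p) (hn : 1 ≤ n)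
    (hx₀ : 0 < x₀) (hx : x₀ ≤ x) (hx1 : x ≤ 1)
    (hend : (2 * (n - 1 + n * 1) ^ (p / 2) / (n + 1)) ^ c = n)
    (hcond : ∀ y, x₀ < y → y < 1 → ∀ w, w = (2 * (n - 1 + n * y) ^ (p / 2) / (n + y ^ p)) ^ c →
      (p - 1) * c * w * (n ^ 2 - 2 * y ^ (p - 1) * n + 2 * y ^ (p - 1) - n * (y ^ (p - 1) * y)) *
        (n + y) ≤ 2 * (n - 1 + n * y) * (n * (1 - y ^ (p - 1))) * (1 + w)) :
    (n + x) ^ (p / (p - 1)) ≤ (n + x ^ p) ^ (1 / (p - 1)) *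
      (1 + (2 * (n - 1 + n * x) ^ (p / 2) / (n + x ^ p)) ^ c) := by
  have ha : 0 < p - 1 := by linarith
  -- Here n is the number of arguments equal to 1; g is the logarithm of the ratio 2 s^(p/2) / P,
  -- and D is the logarithm of the right side minus that of the left. `hend` gives D(1) = 0, and
  -- `hcond` is D' ≤ 0 with positive denominators cleared.
  set g : ℝ → ℝ := fun y => Real.log 2 + p / 2 * Real.log (n - 1 + n * y)
    - Real.log (n + y ^ p) with hg
  set D : ℝ → ℝ := fun y => Real.log (1 + Real.exp (c * g y))
    + 1 / (p - 1) * Real.log (n + y ^ p) - p / (p - 1) * Real.log (n + y) with hD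
  have ht : ∀ y, 0 < y → 0 < n - 1 + n * y := fun y hy => by
    have : 0 < n * y := by positivity
    linarith
  have hm : ∀ y : ℝ, 0 < y → 0 < n + y ^ p := fun y hy => by positivity
  have hw : ∀ y, 0 < y → Real.exp (c * g y)
      = (2 * (n - 1 + n * y) ^ (p / 2) / (n + y ^ p)) ^ c := fun y hy => by
    have h1 := ht y hy
    have h2 := hm y hy
    rw [Real.rpow_def_of_pos (by positivity), Real.log_div (by positivity) h2.ne',
      Real.log_mul (by norm_num) (by positivity), Real.log_rpow h1, mul_comm c]
  have hDx : ∀ y, 0 < y → 0 ≤ D y → (n + y) ^ (p / (p - 1)) ≤ (n + y ^ p) ^ (1 / (p - 1)) *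
      (1 + (2 * (n - 1 + n * y) ^ (p / 2) / (n + y ^ p)) ^ c) := fun y hy h => by
    have h2 := hm y hy
    have hs : 0 < n + y := by positivity
    have hpos : 0 < (n + y ^ p) ^ (1 / (p - 1)) * (1 + Real.exp (c * g y)) := by positivity
    rw [← hw y hy, Real.rpow_def_of_pos hs, ← Real.exp_log hpos, Real.exp_le_exp,
      Real.log_mul (by positivity) (by positivity), Real.log_rpow h2]
    simp only [hD] at h
    linarith
  have hderiv : ∀ y, 0 < y → HasDerivAt D
      (Real.exp (c * g y) * (c * (p / 2 * (n / (n - 1 + n * y)) - p * y ^ (p - 1) / (n + y ^ p)))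
        / (1 + Real.exp (c * g y)) + 1 / (p - 1) * (p * y ^ (p - 1) / (n + y ^ p))
        - p / (p - 1) * (1 / (n + y))) y := fun y hy => by
    have h1 := ht y hy
    have h2 := hm y hy
    have hs : 0 < n + y := by positivity
    have d1 : HasDerivAt (fun y => Real.log (n - 1 + n * y)) (n / (n - 1 + n * y)) y := by
      have := ((hasDerivAt_id y).const_mul n).const_add (n - 1)
      simpa using this.log h1.ne'
    have d2 : HasDerivAt (fun y : ℝ => Real.log (n + y ^ p)) (p * y ^ (p - 1) / (n + y ^ p)) y := by
      have := (Real.hasDerivAt_rpow_const (x := y) (p := p) (Or.inl hy.ne')).const_add n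
      exact this.log h2.ne'
    have d3 : HasDerivAt (fun y : ℝ => Real.log (n + y)) (1 / (n + y)) y := by
      have := (hasDerivAt_id y).const_add n
      exact this.log hs.ne'
    have d4 : HasDerivAt g (p / 2 * (n / (n - 1 + n * y)) - p * y ^ (p - 1) / (n + y ^ p)) y :=
      ((d1.const_mul (p / 2)).const_add (Real.log 2)).sub d2
    have d5 := (((d4.const_mul c).exp).const_add 1).log
      (by positivity : 1 + Real.exp (c * g y) ≠ 0)
    exact (d5.add (d2.const_mul (1 / (p - 1)))).sub (d3.const_mul (p / (p - 1)))
  have hanti : AntitoneOn D (Set.Icc x₀ 1) := by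
    refine antitoneOn_of_deriv_nonpos (convex_Icc _ _)
      (fun y hy => (hderiv y (hx₀.trans_le hy.1)).continuousAt.continuousWithinAt)
      (fun y hy => ?_) (fun y hy => ?_)
    · rw [interior_Icc] at hy
      exact (hderiv y (hx₀.trans hy.1)).differentiableAt.differentiableWithinAt
    · rw [interior_Icc] at hy
      have hy0 := hx₀.trans hy.1
      rw [(hderiv y hy0).deriv]
      have hc := hcond y hy.1 hy.2 _ (hw y hy0)
      have h1 := ht y hy0
      have h2 := hm y hy0
      have hs : 0 < n + y := by positivity
      have hyp : y ^ p = y ^ (p - 1) * y := by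
        rw [← Real.rpow_add_one hy0.ne']; congr 1; ring
      have hw0 := Real.exp_pos (c * g y)
      rw [hyp] at h2 ⊢
      generalize Real.exp (c * g y) = w at hc hw0 ⊢
      generalize y ^ (p - 1) = q at hc h2 ⊢
      have e : w * (c * (p / 2 * (n / (n - 1 + n * y)) - p * q / (n + q * y))) / (1 + w)
          + 1 / (p - 1) * (p * q / (n + q * y)) - p / (p - 1) * (1 / (n + y))
          = p / (2 * (p - 1) * (1 + w) * (n - 1 + n * y) * (n + q * y) * (n + y)) *
            ((p - 1) * c * w * (n ^ 2 - 2 * q * n + 2 * q - n * (q * y)) * (n + y)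
              - 2 * (n - 1 + n * y) * (n * (1 - q)) * (1 + w)) := by
        have hw1 : 1 + w ≠ 0 := by positivity
        have h2' : n + y * q ≠ 0 := by rw [mul_comm y]; exact h2.ne'
        have h2'' := h2.ne'
        field_simp
        ring
      rw [e]
      exact mul_nonpos_of_nonneg_of_nonpos (by positivity) (by linarith)
  have hD1 : D 1 = 0 := by
    have h2 : 0 < n + 1 := by linarith
    have := hw 1 one_pos
    rw [Real.one_rpow, hend] at this
    simp only [hD, this, Real.one_rpow, add_comm 1 n]
    field_simp
    ring
  have := hanti ⟨hx, hx1⟩ ⟨hx.trans hx1, le_rfl⟩ hx1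
  exact hDx x (hx₀.trans_le hx) (hD1 ▸ this)

/-- With e = 4/(3p-2) and θ = pe/2 one has 3θ = e + 2, so the factor 2^e is absorbed into a single
power of 8x. -/
theorem two_mul_rpow_rpow_eq {p x : ℝ} (hp : 3 ≤ p) (hx : 0 ≤ x) :
    (2 * x ^ (p / 2)) ^ (4 / (3 * p - 2)) = (8 * x) ^ (2 * p / (3 * p - 2)) / 4 := by
  have h : 0 < 3 * p - 2 := by linarith
  rw [Real.mul_rpow (by norm_num) (by positivity), Real.mul_rpow (by norm_num) hx,
    ← Real.rpow_mul hx, show (8 : ℝ) = 2 ^ (3 : ℝ) by norm_num, ← Real.rpow_mul (by norm_num),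
    show p / 2 * (4 / (3 * p - 2)) = 2 * p / (3 * p - 2) by field_simp; ring,
    show 3 * (2 * p / (3 * p - 2)) = 4 / (3 * p - 2) + 2 by field_simp; ring,
    Real.rpow_add (by norm_num)]
  norm_num
  ring

/-- The left side is convex and the right side concave in x, with equality at 0, so only x = 0.44
needs checking. There both sides are bounded by affine functions of d = 1/(p-1), the right one
through a tangent at θ = 6/7, the value for p = 3. -/
theorem one_add_rpow_le_of_le {p x : ℝ} (hp : 3 ≤ p) (hx : 0 ≤ x) (hx1 : x ≤ 0.44) :
    (1 + x) ^ (p / (p - 1)) ≤ 1 + (2 * x ^ (p / 2)) ^ (4 / (3 * p - 2)) := by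
  have ha : 0 < p - 1 := by linarith
  have h : 0 < 3 * p - 2 := by linarith
  set s := x / 0.44 with hs
  have hxs : x = s * 0.44 := by rw [hs]; field_simp
  have hs0 : 0 ≤ s := by positivity
  have hs1 : s ≤ 1 := by rw [hs, div_le_one (by norm_num)]; exact hx1
  set d := 1 / (p - 1) with hd
  have hd0 : 0 ≤ d := by positivity
  have hd1 : d ≤ 1 / 2 := by rw [hd]; exact one_div_le_one_div_of_le (by norm_num) (by linarith)
  have hpd : p / (p - 1) = 1 + d := by rw [hd]; field_simp; ring
  set θ := 2 * p / (3 * p - 2) with hθ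
  have h' : p * 3 - 2 ≠ 0 := by linarith
  have hθd : θ * (3 + d) = 2 * (1 + d) := by
    rw [show 3 + d = (3 * p - 2) / (p - 1) by rw [hd]; field_simp; ring, ← hpd, hθ]
    field_simp
  have hθ0 : 0 ≤ θ := by positivity
  have hθ1 : θ ≤ 6 / 7 := by rw [hθ, div_le_iff₀ h]; linarith
  -- θ = 2(1+d)/(3+d) is concave in d; 8/21 is the slope of its chord over 0 ≤ d ≤ 1/2.
  have hθ2 : 6 / 7 - θ ≤ 8 / 21 * (1 / 2 - d) := by
    have : (6 / 7 - θ) * (3 + d) ≤ 8 / 21 * (1 / 2 - d) * (3 + d) := by nlinarith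
    exact le_of_mul_le_mul_right this (by linarith)
  rw [two_mul_rpow_rpow_eq hp hx, hpd]
  have h1 : (1 + x) ^ (1 + d) ≤ 1 - s + s * (1 + 0.44) ^ (1 + d) := by
    rw [hxs]; exact one_add_mul_rpow_le (by norm_num) hs0 hs1 (by linarith)
  have h2 : (1 + 0.44 : ℝ) ^ (1 + d) ≤ 1.44 + 0.576 * d := by
    have : (1 + 0.2 : ℝ) ^ (2 * d) ≤ 1 + 2 * d * 0.2 :=
      rpow_one_add_le_one_add_mul_self (by norm_num) (by linarith) (by linarith)
    rw [Real.rpow_add (by norm_num), Real.rpow_one,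
      show (1 + 0.44 : ℝ) = (1 + 0.2) ^ (2 : ℝ) by norm_num, ← Real.rpow_mul (by norm_num)]
    norm_num at this ⊢
    linarith
  have h3 : s * 3.52 ^ θ ≤ (8 * x) ^ θ := by
    rw [hxs, show 8 * (s * 0.44) = s * 3.52 by ring, Real.mul_rpow hs0 (by norm_num)]
    refine mul_le_mul_of_nonneg_right ?_ (by positivity)
    exact Real.self_le_rpow_of_le_one hs0 hs1 (by linarith)
  have h4 : (2.94 : ℝ) ≤ 3.52 ^ (6 / 7 : ℝ) := by
    have := le_rpow_div_of_pow_le (b := 3.52) (t := 2.94) (m := 6) (n := 7) (by norm_num)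
      (by norm_num) (by norm_num) (by norm_num)
    exact_mod_cast this
  have h5 : 2.94 * (1 - 1.26 * (6 / 7 - θ)) ≤ (3.52 : ℝ) ^ θ := by
    refine le_trans ?_ (rpow_ge_of_log_le (by norm_num) log_three_fifty_two_le hθ1)
    exact mul_le_mul_of_nonneg_right h4 (by linarith)
  have h6 : (1 + 0.44 : ℝ) ^ (1 + d) ≤ 1 + 3.52 ^ θ / 4 := by linarith
  have h7 := mul_le_mul_of_nonneg_left h6 hs0
  linarith

/-- The exponent 4/(3p-2) is at least c. As the ratio is at most 1 here, this is stronger than the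
bound with c, and it is free of logarithms. -/
theorem one_add_rpow_le {p x : ℝ} (hp : 3 ≤ p) (hx : 0 ≤ x) (hx1 : x ≤ 1) :
    (1 + x) ^ (p / (p - 1)) ≤ (1 + x ^ p) ^ (1 / (p - 1)) *
      (1 + (2 * x ^ (p / 2) / (1 + x ^ p)) ^ (4 / (3 * p - 2))) := by
  have ha : 0 < p - 1 := by linarith
  have h : 0 < 3 * p - 2 := by linarith
  set e := 4 / (3 * p - 2) with he
  have he0 : 0 < e := by positivity
  have hep : e * (3 * p - 2) = 4 := by rw [he]; field_simp
  rcases le_total x 0.44 with hx44 | hx44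
  · refine (one_add_rpow_le_of_le hp hx hx44).trans ?_
    have := rpow_mul_one_add_div_rpow_le (P₁ := 1) (P₂ := 1 + x ^ p) (A := 2 * x ^ (p / 2))
      (c := e) (d := 1 / (p - 1)) one_pos (by have : 0 ≤ x ^ p := by positivity
                                              linarith) (by positivity) (by positivity) ?_ ?_
    · simpa using this
    · rw [mul_one_div, he, mul_div_assoc', div_le_div_iff₀ h ha]; linarith
    · have : x ^ (p / 2) ≤ x := Real.rpow_le_self_of_le_one hx hx1 (by linarith)
      have : (2 * x ^ (p / 2) / 1) ^ e ≤ 1 :=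
        Real.rpow_le_one (by positivity) (by linarith) he0.le
      linarith
  · have key := rpow_le_of_deriv_condition (c := e) hp (le_refl (1 : ℝ)) (by norm_num) hx44 hx1
      (by norm_num) ?_
    · simpa using key
    · intro y hy hy1 w hw
      have hy0 : 0 < y := by linarith
      simp only [sub_self, zero_add, one_mul] at hw
      have hq0 : 0 ≤ y ^ (p - 1) := by positivity
      have hq1 : y ^ (p - 1) ≤ 1 := Real.rpow_le_one hy0.le hy1.le ha.le
      have hB := mul_rpow_mul_one_sub_sq_le (a := p - 1) (by linarith) hy0
      have hyp : y ^ p = (y ^ (p / 2)) ^ 2 := by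
        rw [← Real.rpow_natCast, ← Real.rpow_mul hy0.le]; congr 1; push_cast; ring
      have hw0 : 0 ≤ w := by rw [hw]; positivity
      have hw1 : w ≤ 1 := by
        rw [hw]
        refine Real.rpow_le_one (by positivity) ?_ he0.le
        rw [div_le_one (by positivity), hyp]
        nlinarith [sq_nonneg (y ^ (p / 2) - 1)]
      -- For y ≥ 1/2 the bound w ≤ 1 is enough; on the short remaining range w ≤ 5/6 is needed.
      have main : 4 * w * ((p - 1) * (1 + y) + 2 * y ^ 2) ≤ 2 * y * (3 * p - 2) * (1 + w) := by
        rcases le_total (1 / 2) y with hy2 | hy2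
        · have : 0 ≤ (2 * y - 1) * (p - 1 - y) := mul_nonneg (by linarith) (by linarith)
          have h1 : 2 * ((p - 1) * (1 + y) + 2 * y ^ 2) ≤ 2 * y * (3 * p - 2) := by nlinarith
          have h2 : 0 ≤ (p - 1) * (1 + y) + 2 * y ^ 2 := by positivity
          have h3 := mul_le_mul_of_nonneg_right h1 (by linarith : 0 ≤ 1 + w)
          nlinarith [mul_le_mul_of_nonneg_right (by linarith : 2 * w ≤ 1 + w) h2]
        · have hw2 : w ≤ 5 / 6 := by
            have e1 : w ≤ (2 * (1 / 2 : ℝ) ^ (p / 2)) ^ e := by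
              rw [hw]
              refine Real.rpow_le_rpow (by positivity) ?_ he0.le
              refine (div_le_self (by positivity) ?_).trans ?_
              · have : 0 ≤ y ^ p := by positivity
                linarith
              · have := Real.rpow_le_rpow hy0.le hy2 (by linarith : 0 ≤ p / 2)
                linarith
            have e2 : (2 * (1 / 2 : ℝ) ^ (p / 2)) ^ e = (1 / 2 : ℝ) ^ ((p / 2 - 1) * e) := by
              rw [Real.rpow_mul (by norm_num), Real.rpow_sub_one (by norm_num)]
              congr 1; ring
            have e3 : (1 / 2 : ℝ) ^ ((p / 2 - 1) * e) ≤ (1 / 2 : ℝ) ^ (2 / 7 : ℝ) := by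
              refine Real.rpow_le_rpow_of_exponent_ge (by norm_num) (by norm_num) ?_
              rw [he, mul_div_assoc', div_le_div_iff₀ (by norm_num) h]; linarith
            have e4 : (6 / 5 : ℝ) ≤ 2 ^ (2 / 7 : ℝ) := by
              have := le_rpow_div_of_pow_le (b := 2) (t := 6 / 5) (m := 2) (n := 7) (by norm_num)
                (by norm_num) (by norm_num) (by norm_num)
              exact_mod_cast this
            have e5 : (1 / 2 : ℝ) ^ (2 / 7 : ℝ) ≤ 5 / 6 := by
              rw [one_div, Real.inv_rpow (by norm_num)]
              refine (inv_anti₀ (by norm_num) e4).trans (by norm_num)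
            linarith [e2 ▸ e1]
          have h2 : 0 ≤ (p - 1) * (1 + y) + 2 * y ^ 2 := by positivity
          have h1 : 10 * ((p - 1) * (1 + y) + 2 * y ^ 2) ≤ 11 * (y * (3 * p - 2)) := by
            have : 0 ≤ (p - 3) * (y - 0.44) := mul_nonneg (by linarith) (by linarith)
            nlinarith
          have h3 := mul_le_mul_of_nonneg_right h1 (by linarith : 0 ≤ 1 + w)
          nlinarith [mul_le_mul_of_nonneg_right (by linarith : 11 * w ≤ 5 * (1 + w)) h2]
      -- Writing 1 - qy = (1-q) + q(1-y) with q = y^(p-1), Bernoulli's inequality bounds the second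
      -- term by a multiple of 1 - q. The factor 1 - q then splits off, leaving `main`.
      have h1 : (p - 1) * (1 + y) * (1 - y ^ (p - 1) * y)
          ≤ (1 - y ^ (p - 1)) * ((p - 1) * (1 + y) + 2 * y ^ 2) := by nlinarith
      have h2 := mul_le_mul_of_nonneg_left h1 (by positivity : 0 ≤ e * w)
      have h3 := mul_le_mul_of_nonneg_left main
        (mul_nonneg he0.le (by linarith : 0 ≤ 1 - y ^ (p - 1)))
      have h4 : e * (1 - y ^ (p - 1)) * (2 * y * (3 * p - 2) * (1 + w))
          = 4 * (2 * y * (1 * (1 - y ^ (p - 1))) * (1 + w)) := by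
        rw [← hep]; ring
      nlinarith

theorem pair_sum_rpow_le {p x y z : ℝ} (hp : 2 ≤ p) (hx : 0 ≤ x) (hy : 0 ≤ y) (hz : 0 ≤ z) :
    (x * y + x * z + y * z) ^ (p / 2) ≤ 3 ^ (p / 2 - 1) * (x ^ p + y ^ p + z ^ p) := by
  have h1 : x * y + x * z + y * z ≤ x ^ 2 + y ^ 2 + z ^ 2 := by
    nlinarith [sq_nonneg (x - y), sq_nonneg (x - z), sq_nonneg (y - z)]
  have h2 := Real.rpow_sum_le_const_mul_sum_rpow_of_nonneg (s := Finset.univ)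
    (f := ![x ^ 2, y ^ 2, z ^ 2]) (p := p / 2) (by linarith)
    (by intro i _; fin_cases i <;> simp <;> positivity)
  have e : ∀ t : ℝ, 0 ≤ t → (t ^ 2) ^ (p / 2) = t ^ p := fun t ht => by
    rw [← Real.rpow_natCast, ← Real.rpow_mul ht]; congr 1; push_cast; ring
  simp only [Fin.sum_univ_three, Finset.card_univ, Fintype.card_fin, Matrix.cons_val_zero,
    Matrix.cons_val_one, Matrix.cons_val, e x hx, e y hy, e z hz] at h2
  refine (Real.rpow_le_rpow (by positivity) h1 (by linarith)).trans ?_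
  exact_mod_cast h2

/-- The ratio is largest at x = y = z, where its c-th power is exactly 2. This is the condition
under which the right side increases with P. -/
theorem pair_ratio_rpow_le_two {p x y z : ℝ} (hp : 3 ≤ p) (hx : 0 ≤ x) (hy : 0 ≤ y)
    (hz : 0 ≤ z) :
    (2 * (x * y + x * z + y * z) ^ (p / 2) / (x ^ p + y ^ p + z ^ p)) ^ cflExp p ≤ 2 := by
  have hP : 0 ≤ x ^ p + y ^ p + z ^ p := by positivity
  refine le_trans (Real.rpow_le_rpow (by positivity) ?_ (cflExp_pos hp).le)
    (two_mul_rpow_cflExp hp).le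
  refine div_le_of_le_mul₀ hP (by positivity) ?_
  have := pair_sum_rpow_le (p := p) (by linarith) hx hy hz
  linarith

/-- From c ≤ 24/(19p-14) one gets 1 - pc/2 ≥ u = 7(p-2)/(19p-14). The power 1.8^u is bounded by the
tangent at 7/19, the limit of u as p → ∞; 23.56 is 19 · 1.24. -/
theorem one_add_sub_cflExp_rpow_bounds {p : ℝ} (hp : 3 ≤ p) :
    (23.56 * (p - 1) - 0.25) ≤ (19 * p - 14) * 1.8 ^ (1 - p * cflExp p / 2) := by
  have hc := cflExp_le hp
  have hD : 0 < 19 * p - 14 := by linarith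
  set u := 7 * (p - 2) / (19 * p - 14) with hu
  have hu' : u * (19 * p - 14) = 7 * (p - 2) := div_mul_cancel₀ _ hD.ne'
  have hu1 : u ≤ 1 - p * cflExp p / 2 := by
    refine le_of_mul_le_mul_right ?_ hD
    nlinarith
  have hu2 : u ≤ 7 / 19 := by rw [hu, div_le_div_iff₀ hD (by norm_num)]; linarith
  have h1 : (1.8 : ℝ) ^ u ≤ 1.8 ^ (1 - p * cflExp p / 2) :=
    Real.rpow_le_rpow_of_exponent_le (by norm_num) hu1
  have h2 : (1.24 : ℝ) ≤ 1.8 ^ (7 / 19 : ℝ) := by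
    have := le_rpow_div_of_pow_le (b := 1.8) (t := 1.24) (m := 7) (n := 19) (by norm_num)
      (by norm_num) (by norm_num) (by norm_num)
    exact_mod_cast this
  have h3 := rpow_ge_of_log_le (b := 1.8) (u := u) (l := 0.588) (by norm_num)
    (by have := log_nine_fifths_le; norm_num at this ⊢; exact this) hu2
  have h4 : 1.24 * (1 - 0.588 * (7 / 19 - u)) ≤ (1.8 : ℝ) ^ (1 - p * cflExp p / 2) := by
    refine le_trans ?_ (h3.trans h1)
    refine mul_le_mul_of_nonneg_right h2 ?_
    have : 0 ≤ u := div_nonneg (by linarith) hD.le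
    linarith
  refine le_trans ?_ (mul_le_mul_of_nonneg_left h4 hD.le)
  nlinarith

/-- After division by 2^(1/(p-1)), a convex function of x meets a concave one at x = 0, so x = 0.4
is the only point to check; 1.2 and 1.8 are 1 + x/2 and 1 + 2x there. -/
theorem two_add_rpow_le_of_le {p x : ℝ} (hp : 3 ≤ p) (hx : 0 ≤ x) (hx1 : x ≤ 0.4) :
    (2 + x) ^ (p / (p - 1)) ≤
      2 ^ (1 / (p - 1)) * (1 + (1 + 2 * x) ^ (p * cflExp p / 2)) := by
  have ha : 0 < p - 1 := by linarith
  have hc := cflExp_pos hp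
  set s := x / 0.4 with hs
  have hxs : x = s * 0.4 := by rw [hs]; field_simp
  have hs0 : 0 ≤ s := by positivity
  have hs1 : s ≤ 1 := by rw [hs, div_le_one (by norm_num)]; exact hx1
  set d := 1 / (p - 1) with hd
  have hda : d * (p - 1) = 1 := by rw [hd]; field_simp
  have hd0 : 0 ≤ d := by positivity
  have hd1 : d ≤ 1 / 2 := by rw [hd]; exact one_div_le_one_div_of_le (by norm_num) (by linarith)
  have hpd : p / (p - 1) = 1 + d := by rw [hd]; field_simp; ring
  set θ := p * cflExp p / 2 with hθ
  have hθ0 : 0 ≤ θ := by positivity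
  have hθ1 : θ ≤ 1 := by
    have := cflExp_le hp
    rw [hθ]; nlinarith
  -- The left side is the chord over 0 ≤ d ≤ 1/2 of the concave function 5(1+d)/(2(4+d)), which is a
  -- lower bound for θ.
  have hθ2 : 5 / 8 + 5 / 12 * d ≤ θ := by
    have h1 := le_cflExp hp
    have h2 : 5 * p ≤ 2 * θ * (4 * p - 3) := by rw [hθ]; nlinarith
    have h3 : 5 * (1 + d) ≤ 2 * θ * (4 + d) := by
      have := mul_le_mul_of_nonneg_left h2 hd0
      nlinarith
    have h4 : (5 / 8 + 5 / 12 * d) * (2 * (4 + d)) ≤ θ * (2 * (4 + d)) := by nlinarith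
    exact le_of_mul_le_mul_right h4 (by linarith)
  have h1 : (1 + x / 2) ^ (1 + d) ≤ 1 - s + s * (1 + 0.2) ^ (1 + d) := by
    rw [hxs, show s * 0.4 / 2 = s * 0.2 by ring]
    exact one_add_mul_rpow_le (by norm_num) hs0 hs1 (by linarith)
  have h2 : 1 - s + s * (1 + 0.8) ^ θ ≤ (1 + 2 * x) ^ θ := by
    rw [hxs, show 2 * (s * 0.4) = s * 0.8 by ring]
    exact le_one_add_mul_rpow (by norm_num) hs0 hs1 hθ0 hθ1
  have h3 : (1 + 0.2 : ℝ) ^ (1 + d) ≤ 1.2 + 0.2292 * d := by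
    have : (1 + 0.0955 : ℝ) ^ (2 * d) ≤ 1 + 2 * d * 0.0955 :=
      rpow_one_add_le_one_add_mul_self (by norm_num) (by linarith) (by linarith)
    have h' : (1 + 0.2 : ℝ) ^ d ≤ (1 + 0.0955 : ℝ) ^ (2 * d) := by
      rw [Real.rpow_mul (by norm_num)]
      exact Real.rpow_le_rpow (by norm_num) (by norm_num) hd0
    rw [Real.rpow_add (by norm_num), Real.rpow_one]
    norm_num at this h' ⊢
    linarith
  have h4 : (1.632 : ℝ) ≤ 1.8 ^ (5 / 6 : ℝ) := by
    have := le_rpow_div_of_pow_le (b := 1.8) (t := 1.632) (m := 5) (n := 6) (by norm_num)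
      (by norm_num) (by norm_num) (by norm_num)
    exact_mod_cast this
  have h5 : 1.632 * (1 - 0.245 * (1 / 2 - d)) ≤ (1.8 : ℝ) ^ θ := by
    have h6 := rpow_ge_of_log_le (b := 1.8) (u := 5 / 8 + 5 / 12 * d) (v := 5 / 6) (l := 0.588)
      (by norm_num) (by have := log_nine_fifths_le; norm_num at this ⊢; exact this) (by linarith)
    refine le_trans ?_ (h6.trans (Real.rpow_le_rpow_of_exponent_le (by norm_num) hθ2))
    refine le_trans ?_ (mul_le_mul_of_nonneg_right h4 (by linarith))
    linarith
  have h6 : 2 * (1 + 0.2 : ℝ) ^ (1 + d) ≤ 1 + (1 + 0.8 : ℝ) ^ θ := by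
    rw [show (1 + 0.8 : ℝ) = 1.8 by norm_num]; linarith
  have h7 := mul_le_mul_of_nonneg_left h6 hs0
  have h8 : (2 + x) ^ (1 + d) = 2 ^ d * (2 * (1 + x / 2) ^ (1 + d)) := by
    rw [show 2 + x = 2 * (1 + x / 2) by ring, Real.mul_rpow (by norm_num) (by positivity),
      Real.rpow_add (by norm_num) 1 d, Real.rpow_one]
    ring
  rw [hpd, h8]
  refine mul_le_mul_of_nonneg_left ?_ (by positivity)
  linarith

theorem two_add_rpow_le {p x : ℝ} (hp : 3 ≤ p) (hx : 0 ≤ x) (hx1 : x ≤ 1) :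
    (2 + x) ^ (p / (p - 1)) ≤ (2 + x ^ p) ^ (1 / (p - 1)) *
      (1 + (2 * (1 + 2 * x) ^ (p / 2) / (2 + x ^ p)) ^ cflExp p) := by
  have ha : 0 < p - 1 := by linarith
  have hc := cflExp_pos hp
  have hcle := cflExp_le hp
  have e1 : ∀ y : ℝ, 0 ≤ y → ((1 + 2 * y) ^ (p / 2)) ^ cflExp p
      = (1 + 2 * y) ^ (p * cflExp p / 2) := fun y hy => by
    rw [← Real.rpow_mul (by positivity)]; congr 1; ring
  rcases le_total x 0.4 with hx4 | hx4
  · refine (two_add_rpow_le_of_le hp hx hx4).trans ?_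
    have := rpow_mul_one_add_div_rpow_le (P₁ := 2) (P₂ := 2 + x ^ p)
      (A := 2 * (1 + 2 * x) ^ (p / 2)) (c := cflExp p) (d := 1 / (p - 1)) two_pos
      (by have : 0 ≤ x ^ p := by positivity
          linarith) (by positivity) (by positivity) ?_ ?_
    · rwa [mul_div_cancel_left₀ _ (two_ne_zero' ℝ), e1 x hx] at this
    · rw [mul_one_div, le_div_iff₀ ha]; nlinarith
    · rw [mul_div_cancel_left₀ _ (two_ne_zero' ℝ), e1 x hx]
      refine (Real.rpow_le_rpow_of_exponent_le (by linarith)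
        (by nlinarith : p * cflExp p / 2 ≤ 1)).trans ?_
      rw [Real.rpow_one]; linarith
  · have key := rpow_le_of_deriv_condition (c := cflExp p) (n := 2) hp (by norm_num)
      (by norm_num) hx4 hx1 ?_ ?_
    · norm_num at key ⊢
      exact key
    · have h3 : (3 : ℝ) ^ (p / 2) = 3 ^ (p / 2 - 1) * 3 := by
        rw [← Real.rpow_add_one (by norm_num)]; congr 1; ring
      rw [show (2 : ℝ) - 1 + 2 * 1 = 3 by norm_num, h3,
        show 2 * ((3 : ℝ) ^ (p / 2 - 1) * 3) / (2 + 1) = 2 * 3 ^ (p / 2 - 1) by ring]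
      exact two_mul_rpow_cflExp hp
    · intro y hy hy1 w hw
      have hy0 : 0 < y := by linarith
      rw [show (2 : ℝ) - 1 = 1 by norm_num] at hw ⊢
      have hq0 : 0 ≤ y ^ (p - 1) := by positivity
      have hq1 : y ^ (p - 1) ≤ 1 := Real.rpow_le_one hy0.le hy1.le ha.le
      have hB := mul_rpow_mul_one_sub_sq_le (a := p - 1) (by linarith) hy0
      have hw0 : 0 < w := by rw [hw]; positivity
      -- For y ≥ 0.6 the bound w ≤ 2 suffices. Below 0.6 one uses w ≤ (1+2y)^(pc/2), that is, 1 + 2y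
      -- exceeds w by at least the factor 1.8^(1-pc/2).
      have main : 24 * w * ((p - 1) * (1 + y) + y ^ 2) * (2 + y)
          ≤ (19 * p - 14) * ((1 + w) * (1 + y) * (1 + 2 * y)) := by
        rcases le_total 0.6 y with hy6 | hy6
        · have hw2 : w ≤ 2 := by
            have := pair_ratio_rpow_le_two hp zero_le_one zero_le_one hy0.le
            rwa [show (1 : ℝ) * 1 + 1 * y + 1 * y = 1 + 2 * y by ring, Real.one_rpow,
              show (1 : ℝ) + 1 = 2 by norm_num, ← hw] at this
          have h1 : 16 * (((p - 1) * (1 + y) + y ^ 2) * (2 + y))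
              ≤ (19 * p - 14) * ((1 + y) * (1 + 2 * y)) := by
            have : 0 ≤ (p - 3) * ((1 + y) * (22 * y - 13)) :=
              mul_nonneg (by linarith) (mul_nonneg (by linarith) (by linarith))
            nlinarith [mul_nonneg (by linarith : 0 ≤ y - 0.6) (by linarith : 0 ≤ 1 - y),
              mul_nonneg (mul_nonneg (by linarith : 0 ≤ y - 0.6) (by linarith : 0 ≤ 1 - y)) hy0.le]
          have h3 := mul_le_mul_of_nonneg_right h1 (by linarith : 0 ≤ 1 + w)
          have h2 : 0 ≤ ((p - 1) * (1 + y) + y ^ 2) * (2 + y) := by positivity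
          nlinarith [mul_le_mul_of_nonneg_right (by linarith : 3 * w ≤ 2 * (1 + w)) h2]
        · have hw2 : w * 1.8 ^ (1 - p * cflExp p / 2) ≤ 1 + 2 * y := by
            have hθ : 0 ≤ 1 - p * cflExp p / 2 := by nlinarith
            have e2 : w ≤ (1 + 2 * y) ^ (p * cflExp p / 2) := by
              rw [hw, ← e1 y hy0.le]
              refine Real.rpow_le_rpow (by positivity) ?_ hc.le
              rw [div_le_iff₀ (by positivity), mul_comm]
              have h0 : 0 ≤ y ^ p := by positivity
              exact mul_le_mul_of_nonneg_left (by linarith) (by positivity)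
            have e3 : (1.8 : ℝ) ^ (1 - p * cflExp p / 2) ≤ (1 + 2 * y) ^ (1 - p * cflExp p / 2) :=
              Real.rpow_le_rpow (by norm_num) (by linarith) hθ
            calc _ ≤ (1 + 2 * y) ^ (p * cflExp p / 2) * (1 + 2 * y) ^ (1 - p * cflExp p / 2) :=
                  mul_le_mul e2 e3 (by positivity) (by positivity)
              _ = 1 + 2 * y := by rw [← Real.rpow_add (by positivity)]; norm_num
          have hb := one_add_sub_cflExp_rpow_bounds hp
          have h1 : 24 * ((p - 1) * (1 + y) + y ^ 2) * (2 + y)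
              ≤ (1 + y) * ((19 * p - 14) * (1 + 2 * y) + (23.56 * (p - 1) - 0.25)) := by
            have : 0 ≤ (p - 3) * ((1 + y) * (14 * y - 5.44)) :=
              mul_nonneg (by linarith) (mul_nonneg (by linarith) (by linarith))
            nlinarith [mul_nonneg (by linarith : 0 ≤ y - 0.4) (by linarith : 0 ≤ 0.6 - y),
              mul_nonneg (mul_nonneg (by linarith : 0 ≤ y - 0.4) (by linarith : 0 ≤ 0.6 - y))
                hy0.le]
          have h2 := mul_le_mul_of_nonneg_left h1 hw0.le
          have h3 := mul_le_mul_of_nonneg_left hw2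
            (mul_nonneg (by linarith : 0 ≤ 19 * p - 14) (by linarith : 0 ≤ 1 + y))
          have h4 := mul_le_mul_of_nonneg_left hb
            (mul_nonneg hw0.le (by linarith : 0 ≤ 1 + y))
          nlinarith
      have h1 : (p - 1) * (1 + y) * (2 - y ^ (p - 1) - y ^ (p - 1) * y)
          ≤ (1 - y ^ (p - 1)) * (2 * ((p - 1) * (1 + y) + y ^ 2)) := by nlinarith
      have hq : 0 ≤ 1 - y ^ (p - 1) := by linarith
      have h2 := mul_le_mul_of_nonneg_left h1
        (by positivity : 0 ≤ cflExp p * w * (2 + y))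
      have h3 := mul_le_mul_of_nonneg_left main (mul_nonneg hc.le hq)
      have h4 := mul_le_mul_of_nonneg_right hcle
        (by positivity : 0 ≤ (1 - y ^ (p - 1)) * ((1 + w) * (1 + y) * (1 + 2 * y)))
      have h5 : (1 + y) * ((p - 1) * cflExp p * w *
          (2 - y ^ (p - 1) - y ^ (p - 1) * y) * (2 + y)) ≤
          (1 + y) * (2 * (1 + 2 * y) * (1 - y ^ (p - 1)) * (1 + w)) := by
        nlinarith
      have h6 := le_of_mul_le_mul_left h5 (by linarith)
      nlinarith

/-! ### Homogeneity and monotonicity in the power sum. -/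

/-- The homogeneous form of the scalar inequality, in terms of the sum `S`, the second symmetric
function `s` and the power sum `P`. -/
def PairBound (p S s P : ℝ) : Prop :=
  S ^ (p / (p - 1)) ≤ P ^ (1 / (p - 1)) * (1 + (2 * s ^ (p / 2) / P) ^ cflExp p)

theorem PairBound.smul {p S s P t : ℝ} (ht : 0 < t) (hS : 0 ≤ S) (hs : 0 ≤ s) (hP : 0 ≤ P)
    (h : PairBound p S s P) : PairBound p (t * S) (t ^ 2 * s) (t ^ p * P) := by
  have e : (t ^ 2) ^ (p / 2) = t ^ p := by
    rw [← Real.rpow_natCast, ← Real.rpow_mul ht.le]; congr 1; push_cast; ring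
  have htp : 0 < t ^ p := by positivity
  unfold PairBound at h ⊢
  rw [Real.mul_rpow ht.le hS, Real.mul_rpow (by positivity) hs, e, Real.mul_rpow htp.le hP,
    ← Real.rpow_mul ht.le, mul_one_div, mul_assoc,
    show 2 * (t ^ p * s ^ (p / 2)) = t ^ p * (2 * s ^ (p / 2)) by ring,
    mul_div_mul_left _ _ htp.ne']
  exact mul_le_mul_of_nonneg_left h (by positivity)

theorem PairBound.mono {p S s P₁ P₂ : ℝ} (hp : 3 ≤ p) (hs : 0 ≤ s) (hP₁ : 0 < P₁) (hP : P₁ ≤ P₂)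
    (hw : (2 * s ^ (p / 2) / P₁) ^ cflExp p ≤ 2) (h : PairBound p S s P₁) :
    PairBound p S s P₂ := by
  have ha : 0 < p - 1 := by linarith
  have hc := cflExp_pos hp
  have hcle := cflExp_le hp
  refine h.trans (rpow_mul_one_add_div_rpow_le hP₁ hP (by positivity) (by positivity) ?_ hw)
  rw [mul_one_div, le_div_iff₀ ha]
  nlinarith

theorem pairBound_zero_of_le {p y z : ℝ} (hp : 3 ≤ p) (hy : 0 ≤ y) (hz : 0 < z) (hyz : y ≤ z) :
    PairBound p (y + z) (y * z) (y ^ p + z ^ p) := by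
  have hc := cflExp_pos hp
  have hcle := cflExp_le hp
  set x := y / z with hx
  have hyx : y = z * x := by rw [hx]; field_simp
  have hx0 : 0 ≤ x := by positivity
  have hx1 : x ≤ 1 := by rw [hx, div_le_one hz]; exact hyz
  have hxp : x ^ p = (x ^ (p / 2)) ^ 2 := by
    rw [← Real.rpow_natCast, ← Real.rpow_mul hx0]; congr 1; push_cast; ring
  have key : PairBound p (1 + x) x (1 + x ^ p) := by
    refine (one_add_rpow_le hp hx0 hx1).trans (mul_le_mul_of_nonneg_left ?_ (by positivity))
    -- The ratio 2x^(p/2)/(1+x^p) is at most 1, so lowering the exponent from 4/(3p-2) to c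
    -- increases its power.
    refine add_le_add_right (Real.rpow_le_rpow_of_exponent_ge' (by positivity) ?_ hc.le ?_) _
    · rw [div_le_one (by positivity), hxp]
      nlinarith [sq_nonneg (x ^ (p / 2) - 1)]
    · rw [le_div_iff₀ (by linarith)]; nlinarith
  have := key.smul hz (by positivity) hx0 (by positivity)
  rwa [show z * (1 + x) = y + z by rw [hyx]; ring, show z ^ 2 * x = y * z by rw [hyx]; ring,
    show z ^ p * (1 + x ^ p) = y ^ p + z ^ p by
      rw [hyx, Real.mul_rpow hz.le hx0]; ring] at this

theorem pairBound_of_two_equal {p x y : ℝ} (hp : 3 ≤ p) (hx : 0 ≤ x) (hy : 0 < y) (hxy : x ≤ y) :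
    PairBound p (x + 2 * y) (y ^ 2 + 2 * x * y) (x ^ p + 2 * y ^ p) := by
  set r := x / y with hr
  have hxr : x = y * r := by rw [hr]; field_simp
  have hr0 : 0 ≤ r := by positivity
  have hr1 : r ≤ 1 := by rw [hr, div_le_one hy]; exact hxy
  have key : PairBound p (2 + r) (1 + 2 * r) (2 + r ^ p) := two_add_rpow_le hp hr0 hr1
  have := key.smul hy (by positivity) (by positivity) (by positivity)
  rwa [show y * (2 + r) = x + 2 * y by rw [hxr]; ring,
    show y ^ 2 * (1 + 2 * r) = y ^ 2 + 2 * x * y by rw [hxr]; ring,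
    show y ^ p * (2 + r ^ p) = x ^ p + 2 * y ^ p by
      rw [hxr, Real.mul_rpow hy.le hr0]; ring] at this

/-! ### Minimizing the power sum with S and s fixed. -/

/-- A convex function lies above each of its chords outside the chord's interval. -/
theorem ConvexOn.chord_le {g : ℝ → ℝ} {s : Set ℝ} (hg : ConvexOn ℝ s g) {u v r : ℝ} (hu : u ∈ s)
    (hv : v ∈ s) (hr : r ∈ s) (huv : u < v) (h : 0 ≤ (r - u) * (r - v)) :
    g u + (g v - g u) / (v - u) * (r - u) ≤ g r := by
  have hvu : 0 < v - u := by linarith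
  rcases lt_trichotomy r u with h1 | h1 | h1
  · have := hg.slope_mono_adjacent hr hv h1 huv
    rw [div_le_iff₀ (by linarith)] at this
    linarith
  · simp [h1]
  · have h2 : v ≤ r := by
      by_contra! h3
      nlinarith [mul_pos (sub_pos.2 h1) (sub_pos.2 h3)]
    rcases h2.eq_or_lt with h3 | h3
    · rw [← h3, div_mul_cancel₀ _ hvu.ne']; linarith
    · have := hg.slope_mono_adjacent hu hr huv h3
      rw [le_div_iff₀ (by linarith)] at this
      have e : (g v - g u) / (v - u) * (r - u)
        = (g v - g u) / (v - u) * (r - v) + (g v - g u) := by field_simp; ring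
      linarith

/-- At r = x, y, z the cubic r(r-u)(r-v) equals xyz ≥ 0, so a positive r lies outside (u,v), where
r^(p-1) is above its chord. Multiplied by r and summed, the chord gives a quantity depending only on
S and s, hence the same as for (0,u,v). -/
theorem rpow_add_rpow_le_of_sum_eq {p x y z u v : ℝ} (hp : 2 ≤ p) (hx : 0 ≤ x) (hy : 0 ≤ y)
    (hz : 0 ≤ z) (hu : 0 ≤ u) (huv : u < v) (hS : u + v = x + y + z)
    (hs : u * v = x * y + x * z + y * z) : u ^ p + v ^ p ≤ x ^ p + y ^ p + z ^ p := by
  have hg := convexOn_rpow (p := p - 1) (by linarith)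
  have e : ∀ r : ℝ, 0 ≤ r → r ^ p = r * r ^ (p - 1) := fun r hr => by
    rcases hr.eq_or_lt with rfl | hr
    · rw [zero_mul, Real.zero_rpow (by linarith)]
    · rw [mul_comm, ← Real.rpow_add_one hr.ne']; congr 1; ring
  set m := (v ^ (p - 1) - u ^ (p - 1)) / (v - u) with hm
  have hmv : m * (v - u) = v ^ (p - 1) - u ^ (p - 1) := by
    have : v - u ≠ 0 := by linarith
    rw [hm]; field_simp
  have key : ∀ r : ℝ, 0 ≤ r → r * ((r - u) * (r - v)) = x * y * z →
      r * (u ^ (p - 1) + m * (r - u)) ≤ r ^ p := fun r hr h => by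
    rw [e r hr]
    rcases hr.eq_or_lt with rfl | hr
    · simp
    · refine mul_le_mul_of_nonneg_left ?_ hr.le
      refine hg.chord_le hu (by simp only [Set.mem_Ici]; linarith) hr.le huv ?_
      have : 0 ≤ r * ((r - u) * (r - v)) := by rw [h]; positivity
      exact nonneg_of_mul_nonneg_right this hr
  have eq : ∀ r, r * ((r - u) * (r - v)) = r ^ 3 - r ^ 2 * (x + y + z)
      + r * (x * y + x * z + y * z) := fun r => by rw [← hS, ← hs]; ring
  have hx' := key x hx (by rw [eq]; ring)
  have hy' := key y hy (by rw [eq]; ring)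
  have hz' := key z hz (by rw [eq]; ring)
  rw [e u hu, e v (by linarith), show v ^ (p - 1) = u ^ (p - 1) + m * (v - u) by linarith]
  have hsq : x ^ 2 + y ^ 2 + z ^ 2 = u ^ 2 + v ^ 2 := by
    have : (u + v) ^ 2 = (x + y + z) ^ 2 := by rw [hS]
    linarith
  have e1 : x * (u ^ (p - 1) + m * (x - u)) + y * (u ^ (p - 1) + m * (y - u))
      + z * (u ^ (p - 1) + m * (z - u))
      = u ^ (p - 1) * (x + y + z) + m * (x ^ 2 + y ^ 2 + z ^ 2) - m * u * (x + y + z) := by ring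
  rw [hsq, ← hS] at e1
  linarith

/-- If `h' = g` is convex and `h` has a zero at `a` and a double zero at `b > a`, then
`h` is nonnegative from `a` on. -/
theorem nonneg_of_convexOn_deriv {h g : ℝ → ℝ} {a b r : ℝ} (hab : a < b)
    (hg : ConvexOn ℝ (Set.Ici a) g) (hd : ∀ y, a ≤ y → HasDerivAt h (g y) y)
    (ha : h a = 0) (hb : h b = 0) (hgb : g b = 0) (hr : a ≤ r) : 0 ≤ h r := by
  have hcont : ∀ s ⊆ Set.Ici a, ContinuousOn h s := fun s hs y hy =>
    (hd y (hs hy)).continuousAt.continuousWithinAt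
  -- Rolle's theorem gives a second zero ξ of g in (a,b). By convexity g is nonnegative before ξ,
  -- nonpositive on [ξ,b] and nonnegative after b, so h rises from 0, falls back to 0, and rises
  -- again.
  obtain ⟨ξ, hξ, hgξ⟩ := exists_hasDerivAt_eq_zero hab
    (hcont _ Set.Icc_subset_Ici_self) (by rw [ha, hb]) (fun y hy => hd y hy.1.le)
  rcases le_total r ξ with h1 | h1
  · have hm : MonotoneOn h (Set.Icc a ξ) := by
      refine monotoneOn_of_deriv_nonneg (convex_Icc _ _) (hcont _ Set.Icc_subset_Ici_self)
        (fun y hy => ?_) (fun y hy => ?_) <;> rw [interior_Icc] at hy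
      · exact (hd y hy.1.le).differentiableAt.differentiableWithinAt
      · rw [(hd y hy.1.le).deriv]
        have := hg.slope_mono_adjacent (x := y) (z := b) hy.1.le hab.le hy.2 hξ.2
        rw [hgb, hgξ, sub_zero, zero_div, div_le_iff₀ (by linarith [hy.2])] at this
        linarith
    have := hm ⟨le_rfl, hξ.1.le⟩ ⟨hr, h1⟩ hr
    linarith
  · rcases le_total r b with h2 | h2
    · have hm : AntitoneOn h (Set.Icc ξ b) := by
        refine antitoneOn_of_deriv_nonpos (convex_Icc _ _)
          (hcont _ (fun y hy => hξ.1.le.trans hy.1))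
          (fun y hy => ?_) (fun y hy => ?_) <;> rw [interior_Icc] at hy
        · exact (hd y (hξ.1.trans hy.1).le).differentiableAt.differentiableWithinAt
        · rw [(hd y (hξ.1.trans hy.1).le).deriv]
          have := hg.slope_mono_adjacent (x := ξ) (z := b) hξ.1.le hab.le hy.1 hy.2
          rw [hgb, hgξ, sub_zero, zero_sub, div_le_div_iff₀ (by linarith [hy.1])
            (by linarith [hy.2])] at this
          have h3 : g y * (b - ξ) ≤ 0 := by linarith
          by_contra! h4
          nlinarith [mul_pos h4 (sub_pos.2 hξ.2)]
      have := hm ⟨h1, h2⟩ ⟨hξ.2.le, le_rfl⟩ h2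
      linarith
    · have hm : MonotoneOn h (Set.Icc b r) := by
        refine monotoneOn_of_deriv_nonneg (convex_Icc _ _)
          (hcont _ (fun y hy => hab.le.trans hy.1))
          (fun y hy => ?_) (fun y hy => ?_) <;> rw [interior_Icc] at hy
        · exact (hd y (hab.trans hy.1).le).differentiableAt.differentiableWithinAt
        · rw [(hd y (hab.trans hy.1).le).deriv]
          have := hg.slope_mono_adjacent (x := ξ) (z := y) hξ.1.le (hab.trans hy.1).le hξ.2 hy.1
          rw [hgb, hgξ, sub_zero, zero_div, sub_zero] at this
          by_contra! h4
          have := div_neg_of_neg_of_pos h4 (by linarith [hy.1] : 0 < y - b)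
          linarith
      have := hm ⟨le_rfl, h2⟩ ⟨h2, le_rfl⟩ h2
      linarith

/-- The quadratic interpolates r^p at a and to first order at b; the difference has a convex
derivative because p - 1 ≥ 1. -/
theorem hermite_le_rpow {p a b r : ℝ} (hp : 2 ≤ p) (ha : 0 ≤ a) (hab : a < b) (hr : a ≤ r) :
    b ^ p + p * b ^ (p - 1) * (r - b) +
      (a ^ p - b ^ p - p * b ^ (p - 1) * (a - b)) / (a - b) ^ 2 * (r - b) ^ 2 ≤ r ^ p := by
  have hne : a - b ≠ 0 := by linarith
  set κ := (a ^ p - b ^ p - p * b ^ (p - 1) * (a - b)) / (a - b) ^ 2 with hκ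
  have hκ' : κ * (a - b) ^ 2 = a ^ p - b ^ p - p * b ^ (p - 1) * (a - b) := by
    rw [hκ]; field_simp
  have hg : ConvexOn ℝ (Set.Ici a)
      (fun y : ℝ => p * y ^ (p - 1) + (- (p * b ^ (p - 1)) - κ * (2 * (y - b)))) := by
    have h1 : ConvexOn ℝ (Set.Ici a) (fun y : ℝ => p * y ^ (p - 1)) :=
      ((convexOn_rpow (p := p - 1) (by linarith)).subset (Set.Ici_subset_Ici.2 ha)
        (convex_Ici a)).smul (by linarith : 0 ≤ p)
    have h2 : ConvexOn ℝ (Set.Ici a)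
        (fun y : ℝ => - (p * b ^ (p - 1)) - κ * (2 * (y - b))) := by
      refine ⟨convex_Ici a, fun y _ z _ s t _ _ hst => le_of_eq ?_⟩
      simp only [smul_eq_mul]
      linear_combination (p * b ^ (p - 1) - 2 * κ * b) * hst
    exact h1.add h2
  have hd : ∀ y, a ≤ y → HasDerivAt
      (fun y : ℝ => y ^ p - b ^ p - p * b ^ (p - 1) * (y - b) - κ * (y - b) ^ 2)
      (p * y ^ (p - 1) + (- (p * b ^ (p - 1)) - κ * (2 * (y - b)))) y := fun y _ => by
    have d1 := Real.hasDerivAt_rpow_const (x := y) (p := p) (Or.inr (by linarith))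
    have d2 := (hasDerivAt_id y).sub_const b
    have := ((d1.sub_const (b ^ p)).sub (d2.const_mul (p * b ^ (p - 1)))).sub
      ((d2.pow 2).const_mul κ)
    exact this.congr_deriv (by simp; ring)
  have key : 0 ≤ r ^ p - b ^ p - p * b ^ (p - 1) * (r - b) - κ * (r - b) ^ 2 :=
    nonneg_of_convexOn_deriv
      (h := fun y => y ^ p - b ^ p - p * b ^ (p - 1) * (y - b) - κ * (y - b) ^ 2)
      hab hg hd (by linarith) (by ring) (by ring) hr
  linarith

/-- The cubic (r-a)(r-b)² takes the same value xyz - ab² at x, y and z. Were it negative, all three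
would be below a, against S = a + 2b; so all are at least a. The Hermite quadratic then lies below
r^p at each, and its sum depends only on S and s. -/
theorem rpow_add_two_mul_rpow_le_of_sum_eq {p x y z a b : ℝ} (hp : 2 ≤ p) (ha : 0 ≤ a)
    (hab : a ≤ b) (hS : a + 2 * b = x + y + z) (hs : b ^ 2 + 2 * a * b = x * y + x * z + y * z) :
    a ^ p + 2 * b ^ p ≤ x ^ p + y ^ p + z ^ p := by
  have hsq : x ^ 2 + y ^ 2 + z ^ 2 = a ^ 2 + 2 * b ^ 2 := by
    have : (a + 2 * b) ^ 2 = (x + y + z) ^ 2 := by rw [hS]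
    linarith
  rcases hab.eq_or_lt with rfl | hab
  · have h : (x - a) ^ 2 + (y - a) ^ 2 + (z - a) ^ 2 = 0 := by
      linear_combination hsq + 2 * a * hS
    have hx : x = a := by nlinarith [sq_nonneg (x - a), sq_nonneg (y - a), sq_nonneg (z - a)]
    have hy : y = a := by nlinarith [sq_nonneg (x - a), sq_nonneg (y - a), sq_nonneg (z - a)]
    have hz : z = a := by nlinarith [sq_nonneg (x - a), sq_nonneg (y - a), sq_nonneg (z - a)]
    rw [hx, hy, hz]; linarith
  have cub : ∀ r, (r - x) * (r - y) * (r - z) = 0 →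
      (r - a) * (r - b) ^ 2 = x * y * z - a * b ^ 2 := fun r h => by
    linear_combination h - r ^ 2 * hS + r * hs
  have hcx := cub x (by ring)
  have hcy := cub y (by ring)
  have hcz := cub z (by ring)
  have low : 0 ≤ x * y * z - a * b ^ 2 := by
    by_contra! hneg
    have lt : ∀ r, (r - a) * (r - b) ^ 2 = x * y * z - a * b ^ 2 → r < a := fun r h => by
      by_contra! h'
      have := mul_nonneg (sub_nonneg.2 h') (sq_nonneg (r - b))
      linarith
    have := lt x hcx
    have := lt y hcy
    have := lt z hcz
    linarith
  have ge : ∀ r, (r - a) * (r - b) ^ 2 = x * y * z - a * b ^ 2 → a ≤ r := fun r h => by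
    by_contra! h'
    have : 0 < (r - b) ^ 2 := by
      have : r - b ≠ 0 := by linarith
      positivity
    nlinarith
  have h1 := hermite_le_rpow hp ha hab (ge x hcx)
  have h2 := hermite_le_rpow hp ha hab (ge y hcy)
  have h3 := hermite_le_rpow hp ha hab (ge z hcz)
  have h4 : (a ^ p - b ^ p - p * b ^ (p - 1) * (a - b)) / (a - b) ^ 2 * (a - b) ^ 2
      = a ^ p - b ^ p - p * b ^ (p - 1) * (a - b) := by
    have : a - b ≠ 0 := by linarith
    field_simp
  set κ := (a ^ p - b ^ p - p * b ^ (p - 1) * (a - b)) / (a - b) ^ 2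
  have e : (b ^ p + p * b ^ (p - 1) * (x - b) + κ * (x - b) ^ 2)
      + (b ^ p + p * b ^ (p - 1) * (y - b) + κ * (y - b) ^ 2)
      + (b ^ p + p * b ^ (p - 1) * (z - b) + κ * (z - b) ^ 2) = a ^ p + 2 * b ^ p := by
    linear_combination h4 + κ * hsq + (2 * κ * b - p * b ^ (p - 1)) * hS
  linarith

/-- The scalar inequality in homogeneous form. -/
theorem pairBound {p x y z : ℝ} (hp : 3 ≤ p) (hx : 0 ≤ x) (hy : 0 ≤ y) (hz : 0 ≤ z) :
    PairBound p (x + y + z) (x * y + x * z + y * z) (x ^ p + y ^ p + z ^ p) := by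
  have hs0 : 0 ≤ x * y + x * z + y * z := by positivity
  rcases (add_nonneg (add_nonneg hx hy) hz).eq_or_lt with h0 | hSpos
  · have hp0 : p / (p - 1) ≠ 0 := by
      have : 0 < p - 1 := by linarith
      positivity
    unfold PairBound
    rw [← h0, Real.zero_rpow hp0]
    positivity
  have hq : 0 ≤ (x + y + z) ^ 2 - 3 * (x * y + x * z + y * z) := by
    nlinarith [sq_nonneg (x - y), sq_nonneg (x - z), sq_nonneg (y - z)]
  -- The condition decides whether t² - St + s has distinct real roots u < v, so that (0,u,v) has
  -- the given S and s. Otherwise S² ≤ 4s, which is what makes a ≥ 0 in (a,b,b).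
  rcases lt_or_ge (4 * (x * y + x * z + y * z)) ((x + y + z) ^ 2) with h | h
  · obtain ⟨r, hr0, hr⟩ : ∃ r : ℝ, 0 < r ∧ r ^ 2 = (x + y + z) ^ 2 - 4 * (x * y + x * z + y * z) :=
      ⟨√((x + y + z) ^ 2 - 4 * (x * y + x * z + y * z)), Real.sqrt_pos.2 (by linarith),
        Real.sq_sqrt (by linarith)⟩
    obtain ⟨u, hu⟩ : ∃ u, u = (x + y + z - r) / 2 := ⟨_, rfl⟩
    obtain ⟨v, hv⟩ : ∃ v, v = (x + y + z + r) / 2 := ⟨_, rfl⟩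
    have hrS : r ≤ x + y + z := abs_le_of_sq_le_sq' (by linarith) hSpos.le |>.2
    have hu0 : 0 ≤ u := by rw [hu]; linarith
    have huv : u < v := by rw [hu, hv]; linarith
    have hv0 : 0 < v := by linarith
    have hS : u + v = x + y + z := by rw [hu, hv]; ring
    have hs : u * v = x * y + x * z + y * z := by rw [hu, hv]; linear_combination -hr / 4
    have hle := rpow_add_rpow_le_of_sum_eq (p := p) (by linarith) hx hy hz hu0 huv hS hs
    have hb := pairBound_zero_of_le hp hu0 hv0 huv.le
    have hw := pair_ratio_rpow_le_two hp le_rfl hu0 hv0.le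
    rw [Real.zero_rpow (by linarith), zero_mul, zero_mul, zero_add, zero_add, zero_add] at hw
    rw [hs] at hw
    rw [hS, hs] at hb
    exact hb.mono hp hs0 (by positivity) hle hw
  · obtain ⟨r, hr0, hr⟩ : ∃ r : ℝ, 0 ≤ r ∧ r ^ 2 = (x + y + z) ^ 2 - 3 * (x * y + x * z + y * z) :=
      ⟨√((x + y + z) ^ 2 - 3 * (x * y + x * z + y * z)), Real.sqrt_nonneg _, Real.sq_sqrt hq⟩
    obtain ⟨a, ha⟩ : ∃ a, a = (x + y + z - 2 * r) / 3 := ⟨_, rfl⟩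
    obtain ⟨b, hb⟩ : ∃ b, b = (x + y + z + r) / 3 := ⟨_, rfl⟩
    have hrS : 2 * r ≤ x + y + z := abs_le_of_sq_le_sq' (by linarith) hSpos.le |>.2
    have ha0 : 0 ≤ a := by rw [ha]; linarith
    have hab : a ≤ b := by rw [ha, hb]; linarith
    have hb0 : 0 < b := by rw [hb]; linarith
    have hS : a + 2 * b = x + y + z := by rw [ha, hb]; ring
    have hs : b ^ 2 + 2 * a * b = x * y + x * z + y * z := by
      rw [ha, hb]; linear_combination -hr / 3
    have hle := rpow_add_two_mul_rpow_le_of_sum_eq (p := p) (by linarith) ha0 hab hS hs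
    have hbd := pairBound_of_two_equal hp ha0 hb0 hab
    have hw := pair_ratio_rpow_le_two hp ha0 hb0.le hb0.le
    rw [show a * b + a * b + b * b = b ^ 2 + 2 * a * b by ring, hs,
      show a ^ p + b ^ p + b ^ p = a ^ p + 2 * b ^ p by ring] at hw
    rw [hS, hs] at hbd
    exact hbd.mono hp hs0 (by positivity) hle hw

/-! ### Concavity of G, and the pointwise bound in terms of Γ. -/

/-- Up to a constant factor this is G'. It is the (p-2)-th power of P^d (1 + (A/P)^c) at P = 1/t,
with d = (1-c)/(p-2) and A^c = 2; the condition 2c ≤ 3d there becomes c(2p-1) ≤ 3. -/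
theorem antitoneOn_rpow_mul_one_add_rpow {p c : ℝ} (hp : 2 < p) (hc : 0 < c)
    (hcp : c * (2 * p - 1) ≤ 3) {s t : ℝ} (hs : 0 < s) (hst : s ≤ t) (ht : t ≤ 1) :
    t ^ (c - 1) * (1 + 2 * t ^ c) ^ (p - 2) ≤ s ^ (c - 1) * (1 + 2 * s ^ c) ^ (p - 2) := by
  have hp2 : 0 < p - 2 := by linarith
  have ht0 : 0 < t := hs.trans_le hst
  have hc1 : c ≤ 1 := by nlinarith
  have h2c : ((2 : ℝ) ^ (1 / c)) ^ c = 2 := by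
    rw [← Real.rpow_mul (by norm_num), one_div_mul_cancel hc.ne', Real.rpow_one]
  have e : ∀ r : ℝ, 0 < r → ((2 : ℝ) ^ (1 / c) / r⁻¹) ^ c = 2 * r ^ c := fun r hr => by
    rw [div_inv_eq_mul, Real.mul_rpow (by positivity) hr.le, h2c]
  have key := rpow_mul_one_add_div_rpow_le (P₁ := t⁻¹) (P₂ := s⁻¹) (A := 2 ^ (1 / c)) (c := c)
    (d := (1 - c) / (p - 2)) (by positivity) (inv_anti₀ hs hst) (by positivity)
    (div_nonneg (by linarith) hp2.le) ?_ ?_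
  · rw [e t ht0, e s hs] at key
    have e2 : ∀ r : ℝ, 0 < r → (r⁻¹ ^ ((1 - c) / (p - 2)) * (1 + 2 * r ^ c)) ^ (p - 2)
        = r ^ (c - 1) * (1 + 2 * r ^ c) ^ (p - 2) := fun r hr => by
      rw [Real.mul_rpow (by positivity) (by positivity), ← Real.rpow_mul (by positivity),
        div_mul_cancel₀ _ hp2.ne', Real.inv_rpow hr.le, ← Real.rpow_neg hr.le, neg_sub]
    rw [← e2 t ht0, ← e2 s hs]
    exact Real.rpow_le_rpow (by positivity) key hp2.le
  · rw [mul_div_assoc', le_div_iff₀ hp2]; nlinarith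
  · rw [e t ht0]
    have := Real.rpow_le_one ht0.le ht hc.le
    linarith

/-- The function `t ↦ (1 + 2 t ^ c) ^ (p - 1)` lies below its tangents on `[0, 1]`. -/
theorem exists_tangent_one_add_rpow {p c u : ℝ} (hp : 2 < p) (hc : 0 < c)
    (hcp : c * (2 * p - 1) ≤ 3) (hu : 0 < u) (hu1 : u ≤ 1) :
    ∃ k : ℝ, ∀ t, 0 ≤ t → t ≤ 1 →
      (1 + 2 * t ^ c) ^ (p - 1) ≤ (1 + 2 * u ^ c) ^ (p - 1) + k * (t - u) := by
  set G : ℝ → ℝ := fun t => (1 + 2 * t ^ c) ^ (p - 1) with hG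
  set G' : ℝ → ℝ := fun t => 2 * c * (p - 1) * (t ^ (c - 1) * (1 + 2 * t ^ c) ^ (p - 2)) with hG'
  have hd : ∀ t, 0 < t → HasDerivAt G (G' t) t := fun t ht => by
    have d1 := ((Real.hasDerivAt_rpow_const (x := t) (p := c) (Or.inl ht.ne')).const_mul 2).const_add 1
    have d2 := d1.rpow_const (p := p - 1) (Or.inl (by positivity))
    refine d2.congr_deriv ?_
    simp only [hG']
    rw [show p - 1 - 1 = p - 2 by ring]
    ring
  have hcont : ContinuousOn G (Set.Ici 0) := fun t ht => by
    refine ContinuousAt.continuousWithinAt ?_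
    refine ContinuousAt.rpow_const ?_ (Or.inr (by linarith))
    exact continuousAt_const.add (continuousAt_const.mul
      (Real.continuousAt_rpow_const _ _ (Or.inr hc.le)))
  have hanti : ∀ s t, 0 < s → s ≤ t → t ≤ 1 → G' t ≤ G' s := fun s t hs hst ht =>
    mul_le_mul_of_nonneg_left (antitoneOn_rpow_mul_one_add_rpow hp hc hcp hs hst ht)
      (mul_nonneg (by positivity) (by linarith))
  refine ⟨G' u, fun t ht0 ht1 => ?_⟩
  change G t ≤ G u + G' u * (t - u)
  rcases lt_trichotomy t u with h | h | h
  · obtain ⟨ξ, hξ, e⟩ := exists_hasDerivAt_eq_slope G G' h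
      (hcont.mono fun y hy => ht0.trans hy.1) (fun y hy => hd y (ht0.trans_lt hy.1))
    rw [eq_div_iff (by linarith)] at e
    have := mul_le_mul_of_nonneg_right
      (hanti ξ u (ht0.trans_lt hξ.1) hξ.2.le hu1) (by linarith : 0 ≤ u - t)
    linarith
  · rw [h]; simp
  · obtain ⟨ξ, hξ, e⟩ := exists_hasDerivAt_eq_slope G G' h
      (hcont.mono fun y hy => hu.le.trans hy.1) (fun y hy => hd y (hu.trans hy.1))
    rw [eq_div_iff (by linarith)] at e
    have := mul_le_mul_of_nonneg_right
      (hanti u ξ hu hξ.1.le (hξ.2.le.trans ht1)) (by linarith : 0 ≤ t - u)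
    linarith

theorem add_rpow_le_pointwise {p x y z : ℝ} (hp : 3 ≤ p) (hx : 0 ≤ x) (hy : 0 ≤ y) (hz : 0 ≤ z)
    (hP : 0 < x ^ p + y ^ p + z ^ p) :
    (x + y + z) ^ p ≤ (1 + 2 * (3 * (3⁻¹ * (x * y + x * z + y * z)) ^ (p / 2) /
      (x ^ p + y ^ p + z ^ p)) ^ cflExp p) ^ (p - 1) * (x ^ p + y ^ p + z ^ p) := by
  have ha : 0 < p - 1 := by linarith
  have hs : 0 ≤ x * y + x * z + y * z := by positivity
  have key := pairBound hp hx hy hz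
  unfold PairBound at key
  generalize x ^ p + y ^ p + z ^ p = P at *
  generalize x * y + x * z + y * z = s at *
  have h3 : (3 : ℝ) ^ (p / 2 - 1) * 3 = 3 ^ (p / 2) := by
    rw [← Real.rpow_add_one (by norm_num)]; congr 1; ring
  have e : 2 * s ^ (p / 2) / P
      = 2 * 3 ^ (p / 2 - 1) * (3 * (3⁻¹ * s) ^ (p / 2) / P) := by
    rw [Real.mul_rpow (by norm_num) hs, Real.inv_rpow (by norm_num), ← h3]
    field_simp
  rw [e, Real.mul_rpow (by positivity) (by positivity), two_mul_rpow_cflExp hp] at key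
  have := Real.rpow_le_rpow (by positivity) key ha.le
  rw [← Real.rpow_mul (by positivity), div_mul_cancel₀ _ ha.ne',
    Real.mul_rpow (by positivity) (by positivity), ← Real.rpow_mul hP.le,
    one_div_mul_cancel ha.ne', Real.rpow_one] at this
  linarith

/-! ### From the scalar inequality to L^p functions. -/

theorem lpNorm_rpow_eq_integral {X E : Type*} [MeasurableSpace X] [NormedAddCommGroup E]
    {μ : Measure X} {q : ℝ} (hq : 0 < q) {f : X → E} (hf : AEStronglyMeasurable f μ) :
    lpNorm f (ENNReal.ofReal q) μ ^ q = ∫ x, ‖f x‖ ^ q ∂μ := by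
  rw [lpNorm_eq_integral_norm_rpow_toReal (by simpa using hq) ENNReal.ofReal_ne_top hf,
    ENNReal.toReal_ofReal hq.le, Real.rpow_inv_rpow (integral_nonneg fun x => by positivity) hq.ne']

theorem sum_pairs_fin_three (a : Fin 3 → Fin 3 → ℝ) :
    ∑ j, ∑ k ∈ Finset.Ioi j, a j k = a 0 1 + a 0 2 + a 1 2 := by
  rw [Fin.sum_univ_three, show Finset.Ioi (0 : Fin 3) = {1, 2} by decide,
    show Finset.Ioi (1 : Fin 3) = {2} by decide, show Finset.Ioi (2 : Fin 3) = ∅ by decide,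
    Finset.sum_pair (by decide), Finset.sum_singleton, Finset.sum_empty, add_zero]

theorem cflBeta_three (p : ℝ) : cflBeta 3 p = cflExp p := by
  simp only [cflBeta, cflExp]
  norm_num

section

variable {X 𝕜 : Type*} [MeasurableSpace X] [RCLike 𝕜] {μ : Measure X} {p : ℝ}
  {f : Fin 3 → X → 𝕜}

theorem cflGamma_three (hp : 3 ≤ p) (hf : ∀ j, AEStronglyMeasurable (f j) μ) :
    cflGamma p μ f = 3 * (∫ x, (3⁻¹ * (‖f 0 x‖ * ‖f 1 x‖ + ‖f 0 x‖ * ‖f 2 x‖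
        + ‖f 1 x‖ * ‖f 2 x‖)) ^ (p / 2) ∂μ) /
      (∫ x, ‖f 0 x‖ ^ p ∂μ + ∫ x, ‖f 1 x‖ ^ p ∂μ + ∫ x, ‖f 2 x‖ ^ p ∂μ) := by
  have hp0 : 0 < p := by linarith
  unfold cflGamma
  simp only [sum_pairs_fin_three, norm_mul,
    show ((Nat.choose 3 2 : ℕ) : ℝ)⁻¹ = 3⁻¹ by norm_num [Nat.choose]]
  have hm : AEStronglyMeasurable (fun x => (3 : ℝ)⁻¹ * (‖f 0 x‖ * ‖f 1 x‖ + ‖f 0 x‖ * ‖f 2 x‖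
        + ‖f 1 x‖ * ‖f 2 x‖)) μ :=
    (((((hf 0).norm.mul (hf 1).norm).add ((hf 0).norm.mul (hf 2).norm)).add
      ((hf 1).norm.mul (hf 2).norm)).const_mul _)
  rw [lpNorm_rpow_eq_integral (by linarith) hm, Fin.sum_univ_three,
    lpNorm_rpow_eq_integral hp0 (hf 0), lpNorm_rpow_eq_integral hp0 (hf 1),
    lpNorm_rpow_eq_integral hp0 (hf 2)]
  have : ∀ x, ‖(3 : ℝ)⁻¹ * (‖f 0 x‖ * ‖f 1 x‖ + ‖f 0 x‖ * ‖f 2 x‖ + ‖f 1 x‖ * ‖f 2 x‖)‖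
      = 3⁻¹ * (‖f 0 x‖ * ‖f 1 x‖ + ‖f 0 x‖ * ‖f 2 x‖ + ‖f 1 x‖ * ‖f 2 x‖) := fun x =>
    Real.norm_of_nonneg (by positivity)
  simp only [this]
  push_cast
  rw [inv_mul_eq_div, div_div_eq_mul_div, mul_comm]

end

section

variable {X 𝕜 : Type*} [MeasurableSpace X] [RCLike 𝕜] {μ : Measure X} {p : ℝ}
  {f : Fin 3 → X → 𝕜}

theorem three_mul_avg_rpow_le {x y z : ℝ} (hp : 3 ≤ p) (hx : 0 ≤ x) (hy : 0 ≤ y) (hz : 0 ≤ z) :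
    3 * (3⁻¹ * (x * y + x * z + y * z)) ^ (p / 2) ≤ x ^ p + y ^ p + z ^ p := by
  have h3 : (3 : ℝ) ^ (p / 2 - 1) * 3 = 3 ^ (p / 2) := by
    rw [← Real.rpow_add_one (by norm_num)]; congr 1; ring
  have h := pair_sum_rpow_le (p := p) (by linarith) hx hy hz
  rw [Real.mul_rpow (by norm_num) (by positivity), Real.inv_rpow (by norm_num), ← h3,
    ← mul_assoc, mul_inv, mul_comm (3 : ℝ), mul_assoc (((3 : ℝ) ^ (p / 2 - 1))⁻¹),
    inv_mul_cancel₀ (by norm_num), mul_one, inv_mul_le_iff₀ (by positivity)]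
  exact h

theorem add_rpow_eq_zero_of_power_sum {x y z : ℝ} (hp : 3 ≤ p) (hx : 0 ≤ x) (hy : 0 ≤ y)
    (hz : 0 ≤ z) (hP : x ^ p + y ^ p + z ^ p = 0) : (x + y + z) ^ p = 0 := by
  have hp0 : p ≠ 0 := by linarith
  have h1 : 0 ≤ x ^ p := by positivity
  have h2 : 0 ≤ y ^ p := by positivity
  have h3 : 0 ≤ z ^ p := by positivity
  rw [(Real.rpow_eq_zero hx hp0).1 (by linarith), (Real.rpow_eq_zero hy hp0).1 (by linarith),
    (Real.rpow_eq_zero hz hp0).1 (by linarith)]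
  simp [hp0]

theorem integrable_norm_rpow_of_memLp {E : Type*} [NormedAddCommGroup E] {g : X → E}
    (hp : 0 < p) (hg : MemLp g (ENNReal.ofReal p) μ) : Integrable (fun x => ‖g x‖ ^ p) μ := by
  have := hg.integrable_norm_rpow (by simpa using hp) ENNReal.ofReal_ne_top
  rwa [ENNReal.toReal_ofReal hp.le] at this

/-- This is Jensen's inequality for G and the measure h dμ, carried out by integrating the tangent
to G at Γ. -/
theorem integral_norm_sum_rpow_le (hp : 3 ≤ p) (hf : ∀ j, MemLp (f j) (ENNReal.ofReal p) μ) :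
    ∫ x, ‖∑ j, f j x‖ ^ p ∂μ ≤ (1 + 2 * cflGamma p μ f ^ cflExp p) ^ (p - 1) *
      (∫ x, ‖f 0 x‖ ^ p ∂μ + ∫ x, ‖f 1 x‖ ^ p ∂μ + ∫ x, ‖f 2 x‖ ^ p ∂μ) := by
  have hp0 : 0 < p := by linarith
  have hc := cflExp_pos hp
  have hm := fun j => (hf j).aestronglyMeasurable
  have hi := fun j => integrable_norm_rpow_of_memLp hp0 (hf j)
  have hS : Integrable (fun x => ‖∑ j, f j x‖ ^ p) μ :=
    integrable_norm_rpow_of_memLp hp0 (memLp_finsetSum _ fun j _ => hf j)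
  set Q : X → ℝ := fun x => (3⁻¹ * (‖f 0 x‖ * ‖f 1 x‖ + ‖f 0 x‖ * ‖f 2 x‖
    + ‖f 1 x‖ * ‖f 2 x‖)) ^ (p / 2) with hQ
  set h : X → ℝ := fun x => ‖f 0 x‖ ^ p + ‖f 1 x‖ ^ p + ‖f 2 x‖ ^ p with hh
  have hint : Integrable h μ := ((hi 0).add (hi 1)).add (hi 2)
  have hH : ∫ x, ‖f 0 x‖ ^ p ∂μ + ∫ x, ‖f 1 x‖ ^ p ∂μ + ∫ x, ‖f 2 x‖ ^ p ∂μ = ∫ x, h x ∂μ := by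
    rw [← integral_add (hi 0) (hi 1)]
    exact (integral_add ((hi 0).add (hi 1)) (hi 2)).symm
  have hQ0 : ∀ x, 0 ≤ Q x := fun x => by positivity
  have hh0 : ∀ x, 0 ≤ h x := fun x => by positivity
  have hQh : ∀ x, 3 * Q x ≤ h x := fun x =>
    three_mul_avg_rpow_le hp (norm_nonneg _) (norm_nonneg _) (norm_nonneg _)
  have hQm : AEStronglyMeasurable Q μ := by
    have : AEStronglyMeasurable (fun x => (3 : ℝ)⁻¹ * (‖f 0 x‖ * ‖f 1 x‖ + ‖f 0 x‖ * ‖f 2 x‖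
        + ‖f 1 x‖ * ‖f 2 x‖)) μ :=
      (((((hm 0).norm.mul (hm 1).norm).add ((hm 0).norm.mul (hm 2).norm)).add
        ((hm 1).norm.mul (hm 2).norm)).const_mul _)
    exact (this.aemeasurable.pow_const (p / 2)).aestronglyMeasurable
  have hQi : Integrable Q μ := hint.mono' hQm (.of_forall fun x => by
    rw [Real.norm_of_nonneg (hQ0 x)]; linarith [hQ0 x, hQh x])
  have hIQ : 0 ≤ ∫ x, Q x ∂μ := integral_nonneg hQ0
  have hIle : 3 * ∫ x, Q x ∂μ ≤ ∫ x, h x ∂μ := by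
    rw [← integral_const_mul]
    exact integral_mono (hQi.const_mul 3) hint hQh
  have hle : ∀ x, ‖∑ j, f j x‖ ^ p ≤ (‖f 0 x‖ + ‖f 1 x‖ + ‖f 2 x‖) ^ p := fun x => by
    rw [Fin.sum_univ_three]
    exact Real.rpow_le_rpow (norm_nonneg _) norm_add₃_le hp0.le
  have hz : ∀ x, h x = 0 → (‖f 0 x‖ + ‖f 1 x‖ + ‖f 2 x‖) ^ p = 0 := fun x hx =>
    add_rpow_eq_zero_of_power_sum hp (norm_nonneg _) (norm_nonneg _) (norm_nonneg _) hx
  have hpt : ∀ x, 0 < h x → (‖f 0 x‖ + ‖f 1 x‖ + ‖f 2 x‖) ^ p ≤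
      (1 + 2 * (3 * Q x / h x) ^ cflExp p) ^ (p - 1) * h x := fun x hx =>
    add_rpow_le_pointwise hp (norm_nonneg _) (norm_nonneg _) (norm_nonneg _) hx
  rw [cflGamma_three hp hm, hH]
  change _ ≤ (1 + 2 * (3 * (∫ x, Q x ∂μ) / _) ^ cflExp p) ^ (p - 1) * _
  -- The case Γ = 0 is separate because G has a vertical tangent at 0 (c < 1). There Q vanishes
  -- almost everywhere and the pointwise bound already has factor 1.
  rcases hIQ.eq_or_lt with hI0 | hI0
  · rw [← hI0, mul_zero, zero_div, Real.zero_rpow hc.ne', mul_zero, add_zero, Real.one_rpow,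
      one_mul]
    have hae := (integral_eq_zero_iff_of_nonneg hQ0 hQi).1 hI0.symm
    refine integral_mono_ae hS hint ?_
    filter_upwards [hae] with x hx
    refine (hle x).trans ?_
    rcases (hh0 x).eq_or_lt with h0 | h0
    · rw [hz x h0.symm]; exact hh0 x
    · have := hpt x h0
      rwa [hx, Pi.zero_apply, mul_zero, zero_div, Real.zero_rpow hc.ne', mul_zero, add_zero,
        Real.one_rpow, one_mul] at this
  · have hHpos : 0 < ∫ x, h x ∂μ := by linarith
    set Γ := 3 * (∫ x, Q x ∂μ) / ∫ x, h x ∂μ with hΓ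
    have hΓH : Γ * ∫ x, h x ∂μ = 3 * ∫ x, Q x ∂μ := div_mul_cancel₀ _ hHpos.ne'
    have hcp : cflExp p * (2 * p - 1) ≤ 3 := by
      have := cflExp_le hp
      nlinarith
    obtain ⟨k, hk⟩ := exists_tangent_one_add_rpow (u := Γ) (by linarith : 2 < p) hc hcp
      (by positivity) (by rw [hΓ, div_le_one hHpos]; exact hIle)
    set G := (1 + 2 * Γ ^ cflExp p) ^ (p - 1)
    have hpw : ∀ x, ‖∑ j, f j x‖ ^ p ≤ (G - k * Γ) * h x + 3 * k * Q x := fun x => by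
      refine (hle x).trans ?_
      rcases (hh0 x).eq_or_lt with h0 | h0
      · have : Q x = 0 := by linarith [hQ0 x, hQh x]
        rw [hz x h0.symm, ← h0, this]; simp
      · refine (hpt x h0).trans ?_
        have h1 := hk (3 * Q x / h x) (div_nonneg (by linarith [hQ0 x]) h0.le)
          (by rw [div_le_one h0]; exact hQh x)
        refine (mul_le_mul_of_nonneg_right h1 h0.le).trans (le_of_eq ?_)
        field_simp
        ring
    refine (integral_mono hS ((hint.const_mul _).add (hQi.const_mul _)) hpw).trans (le_of_eq ?_)
    change ∫ x, (G - k * Γ) * h x + 3 * k * Q x ∂μ = _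
    rw [integral_add (hint.const_mul _) (hQi.const_mul _), integral_const_mul, integral_const_mul]
    linear_combination -k * hΓH

theorem cflInequality_three (hp : 3 ≤ p) : CFLInequality 𝕜 μ 3 p (cflExp p) := by
  intro f hf
  have hp0 : 0 < p := by linarith
  have hm := fun j => (hf j).aestronglyMeasurable
  have key := integral_norm_sum_rpow_le hp hf
  have hSm : AEStronglyMeasurable (fun x => ∑ j, f j x) μ :=
    (memLp_finsetSum _ fun j _ => hf j).aestronglyMeasurable
  have hΓ : 0 ≤ cflGamma p μ f := by
    unfold cflGamma
    exact div_nonneg (Real.rpow_nonneg lpNorm_nonneg _) (mul_nonneg (by positivity)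
      (Finset.sum_nonneg fun j _ => Real.rpow_nonneg lpNorm_nonneg _))
  rw [← lpNorm_rpow_eq_integral hp0 hSm, ← lpNorm_rpow_eq_integral hp0 (hm 0),
    ← lpNorm_rpow_eq_integral hp0 (hm 1), ← lpNorm_rpow_eq_integral hp0 (hm 2),
    ← Fin.sum_univ_three (fun j => lpNorm (f j) (ENNReal.ofReal p) μ ^ p)] at key
  have hb : 0 ≤ 1 + 2 * cflGamma p μ f ^ cflExp p := by positivity
  have hsum : 0 ≤ ∑ j, lpNorm (f j) (ENNReal.ofReal p) μ ^ p :=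
    Finset.sum_nonneg fun j _ => Real.rpow_nonneg lpNorm_nonneg _
  have := Real.rpow_le_rpow (Real.rpow_nonneg lpNorm_nonneg _) key (by positivity : 0 ≤ 1 / p)
  rw [← Real.rpow_mul lpNorm_nonneg, mul_one_div_cancel hp0.ne', Real.rpow_one,
    Real.mul_rpow (by positivity) hsum, ← Real.rpow_mul hb] at this
  rw [show 1 / p.conjExponent = (p - 1) * (1 / p) by
    rw [Real.conjExponent, one_div_div, mul_one_div]]
  convert this using 4
  norm_num

/-! ### Optimality of the power. -/

theorem le_cflExp_of_cflInequality (hp : 3 ≤ p) {A : Set X} (hA : MeasurableSet A)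
    (h0 : 0 < μ A) (h1 : μ A < ⊤) {r : ℝ} (h : CFLInequality 𝕜 μ 3 p r) :
    r ≤ cflExp p := by
  have hp0 : 0 < p := by linarith
  have hM : 0 < μ.real A := ENNReal.toReal_pos h0.ne' h1.ne
  -- For (1_A, 1_A, 0) one has Γ = 1/(2·3^(p/2-1)) < 1 and Γ^c = 1/2, while the inequality with
  -- power r reduces to 2 ≤ 1 + 2Γ^r. Hence Γ^c ≤ Γ^r, so r ≤ c.
  set g : X → 𝕜 := A.indicator fun _ => 1 with hg
  have hgL : MemLp g (ENNReal.ofReal p) μ := memLp_indicator_const _ hA _ (Or.inr h1.ne)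
  have hf : ∀ j, MemLp ((![g, g, 0] : Fin 3 → X → 𝕜) j) (ENNReal.ofReal p) μ := by
    intro j
    fin_cases j
    · exact hgL
    · exact hgL
    · exact MemLp.zero
  have hm := fun j => (hf j).aestronglyMeasurable
  have hI : ∀ c : ℝ, ∫ x, A.indicator (fun _ => c) x ∂μ = μ.real A * c := fun c => by
    rw [integral_indicator_const _ hA, smul_eq_mul]
  have e1 : ∫ x, ‖g x‖ ^ p ∂μ = μ.real A := by
    have : (fun x => ‖g x‖ ^ p) = A.indicator fun _ => (1 : ℝ) := by
      ext x; by_cases hx : x ∈ A <;> simp [hg, hx, hp0.ne']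
    rw [this, hI, mul_one]
  have e2 : ∫ x, ‖∑ j, (![g, g, 0] : Fin 3 → X → 𝕜) j x‖ ^ p ∂μ = μ.real A * 2 ^ p := by
    have : (fun x => ‖∑ j, (![g, g, 0] : Fin 3 → X → 𝕜) j x‖ ^ p)
        = A.indicator fun _ => (2 : ℝ) ^ p := by
      ext x
      by_cases hx : x ∈ A
      · simp [Fin.sum_univ_three, hg, hx, one_add_one_eq_two]
      · simp [Fin.sum_univ_three, hg, hx, hp0.ne']
    rw [this, hI]
  have e3 : ∫ x, (3⁻¹ * (‖g x‖ * ‖g x‖ + ‖g x‖ * ‖(0 : 𝕜)‖ + ‖g x‖ * ‖(0 : 𝕜)‖)) ^ (p / 2) ∂μ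
      = μ.real A * 3⁻¹ ^ (p / 2) := by
    have : (fun x => (3⁻¹ * (‖g x‖ * ‖g x‖ + ‖g x‖ * ‖(0 : 𝕜)‖ + ‖g x‖ * ‖(0 : 𝕜)‖)) ^ (p / 2))
        = A.indicator fun _ => (3⁻¹ : ℝ) ^ (p / 2) := by
      ext x; by_cases hx : x ∈ A <;> simp [hg, hx, hp0.ne']
    rw [this, hI]
  have hΓ : cflGamma p μ ![g, g, 0] = (2 * 3 ^ (p / 2 - 1))⁻¹ := by
    rw [cflGamma_three hp hm]
    change 3 * (∫ x, (3⁻¹ * (‖g x‖ * ‖g x‖ + ‖g x‖ * ‖(0 : 𝕜)‖ + ‖g x‖ * ‖(0 : 𝕜)‖)) ^ (p / 2) ∂μ)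
      / (∫ x, ‖g x‖ ^ p ∂μ + ∫ x, ‖g x‖ ^ p ∂μ + ∫ x, ‖(0 : 𝕜)‖ ^ p ∂μ) = _
    have h3 : (3 : ℝ) ^ (p / 2) = 3 ^ (p / 2 - 1) * 3 := by
      rw [← Real.rpow_add_one (by norm_num)]; congr 1; ring
    rw [e1, e3, norm_zero, Real.zero_rpow hp0.ne', integral_zero, Real.inv_rpow (by norm_num), h3]
    field_simp
    ring
  have hSm : AEStronglyMeasurable (fun x => ∑ j, (![g, g, 0] : Fin 3 → X → 𝕜) j x) μ :=
    (memLp_finsetSum _ fun j _ => hf j).aestronglyMeasurable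
  have e4 : ∑ j, lpNorm ((![g, g, 0] : Fin 3 → X → 𝕜) j) (ENNReal.ofReal p) μ ^ p
      = 2 * μ.real A := by
    rw [Fin.sum_univ_three]
    change lpNorm g (ENNReal.ofReal p) μ ^ p + lpNorm g (ENNReal.ofReal p) μ ^ p
      + lpNorm (0 : X → 𝕜) (ENNReal.ofReal p) μ ^ p = _
    rw [lpNorm_rpow_eq_integral hp0 hgL.aestronglyMeasurable, e1, lpNorm_zero,
      Real.zero_rpow hp0.ne']
    ring
  have key := Real.rpow_le_rpow lpNorm_nonneg (h ![g, g, 0] hf) hp0.le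
  have hγ : (0 : ℝ) < (2 * 3 ^ (p / 2 - 1))⁻¹ := by positivity
  have hγ1 : ((2 : ℝ) * 3 ^ (p / 2 - 1))⁻¹ < 1 := by
    refine inv_lt_one_of_one_lt₀ ?_
    have : (1 : ℝ) ≤ 3 ^ (p / 2 - 1) := Real.one_le_rpow (by norm_num) (by linarith)
    linarith
  have hγc : ((2 : ℝ) * 3 ^ (p / 2 - 1))⁻¹ ^ cflExp p = 2⁻¹ := by
    rw [Real.inv_rpow (by positivity), two_mul_rpow_cflExp hp]
  rw [lpNorm_rpow_eq_integral hp0 hSm, e2, e4, hΓ] at key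
  generalize ((2 : ℝ) * 3 ^ (p / 2 - 1))⁻¹ = γ at *
  have hB : (0 : ℝ) ≤ 1 + ((3 : ℕ) - 1 : ℝ) * γ ^ r := by
    have : 0 < γ ^ r := by positivity
    norm_num
    linarith
  have hp1 : 0 < p - 1 := by linarith
  rw [Real.mul_rpow (by positivity) (by positivity), ← Real.rpow_mul hB,
    ← Real.rpow_mul (by positivity), one_div_mul_cancel hp0.ne', Real.rpow_one,
    show 1 / p.conjExponent * p = p - 1 by rw [Real.conjExponent, one_div_div]; field_simp,
    show (2 : ℝ) ^ p = 2 ^ (p - 1) * 2 by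
      rw [← Real.rpow_add_one (by norm_num)]; congr 1; ring,
    show μ.real A * ((2 : ℝ) ^ (p - 1) * 2) = 2 ^ (p - 1) * (2 * μ.real A) by ring] at key
  have h2 := le_of_mul_le_mul_right key (by positivity)
  rw [Real.rpow_le_rpow_iff (by norm_num) hB hp1] at h2
  have h3 : γ ^ cflExp p ≤ γ ^ r := by
    rw [hγc]; push_cast at h2; linarith
  exact (Real.rpow_le_rpow_left_iff_of_base_lt_one hγ hγ1).1 h3

end

theorem theorem3 (p : ℝ) (hp : 3 ≤ p) :
    -- the inequality holds with power `β(3, p)` on every measure space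
    (∀ (X : Type*) [MeasurableSpace X] (μ : Measure X) (𝕜 : Type*) [RCLike 𝕜],
      CFLInequality 𝕜 μ 3 p (cflBeta 3 p)) ∧
    -- no larger power is possible, on any measure space with a set of finite positive measure
    (∀ (X : Type*) [MeasurableSpace X] (μ : Measure X) (𝕜 : Type*) [RCLike 𝕜],
      (∃ A : Set X, MeasurableSet A ∧ 0 < μ A ∧ μ A < ⊤) →
        ∀ r : ℝ, 0 < r → CFLInequality 𝕜 μ 3 p r → r ≤ cflBeta 3 p) ∧
    -- the value of the optimal power, and the comparison with the earlier one
    cflBeta 3 p = 2 * Real.log 2 / ((p - 2) * Real.log 3 + 2 * Real.log 2) ∧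
    6 / (5 * p - 4) < cflBeta 3 p ∧
    -- the scalar inequality
    (∀ x y z : ℝ, 0 ≤ x → 0 ≤ y → 0 ≤ z → x ^ p + y ^ p + z ^ p = 1 →
      (x + y + z) ^ p.conjExponent ≤
        1 + (2 * (x * y + x * z + y * z) ^ (p / 2)) ^
          (2 * Real.log 2 / ((p - 2) * Real.log 3 + 2 * Real.log 2))) := by
  have hexp : cflExp p = 2 * Real.log 2 / ((p - 2) * Real.log 3 + 2 * Real.log 2) := by
    rw [cflExp, ← mul_div_mul_left _ _ (two_ne_zero' ℝ)]
    congr 1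
    ring
  rw [cflBeta_three, ← hexp]
  refine ⟨fun X _ μ 𝕜 _ => cflInequality_three hp, ?_, rfl, ?_, ?_⟩
  · rintro X _ μ 𝕜 _ ⟨A, hA, h0, h1⟩ r - h
    exact le_cflExp_of_cflInequality hp hA h0 h1 h
  · have hc := le_cflExp hp
    rw [div_lt_iff₀ (by linarith)]
    nlinarith [cflExp_pos hp]
  · intro x y z hx hy hz h
    have := pairBound hp hx hy hz
    rwa [PairBound, h, Real.one_rpow, one_mul, div_one] at this
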